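/- **Setting.** Let $N\ge 1$, $V=\{1,\dots,N\}$, and let $F:2^V\to\mathbb R$ be submodular with $F(\emptyset)=0$. Let $B(F)=\{x\in\mathbb R^N : x(S)\le F(S)\ \forall S\subseteq V,\ x(V)=F(V)\}$ be its base polyhedron, where $x(S)=\sum_{\ell\in S}x_\ell$, and let $G$ be the matrix whose columns are the vertices of $B(F)$. Consider the linear program $$\min_{\theta,\alpha,\beta}\ \mathbf 1^\top\beta\quad\text{s.t.}\quad G\theta-\alpha+\beta=0,\ \ \mathbf 1^\top\theta=1,\ \ \theta,\alpha,\beta\ge 0. \tag{LP}$$ **Bases.** All linear programs below have $N+1$ equality constraints with right-hand side $b=(0,\dots,0,1)^\top$. A column has a cost $c$ and a coefficient vector $a\in\mathbb R^{N+1}$: a point $x\in\mathbb R^N$ gives the column $(c,a)=(0,(x,1))$, $\alpha_k$ gives $(0,-e_k)$, $\beta_k$ gives $(1,e_k)$, and the $N+1$ artificial variables give $(M,e_1),\dots,(M,e_{N+1})$. A basis $B$ is a set of $N+1$ columns with linearly independent coefficient vectors; $A_B$ is the matrix they form. Its dual vector is $(u,v)^\top=c_B^\top A_B^{-1}$, with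 $u\in\mathbb R^N$ belonging to $G\theta-\alpha+\beta=0$, and the reduced cost of a column $(c,a)$ is $c-(u,v)^\top a$. Columns are ordered as follows: first the columns of points and the artificial ones, lexicographically as vectors $(c,a)$, then $\alpha_1,\dots,\alpha_N$, then $\beta_1,\dots,\beta_N$. The *lexicographically optimal basis* of a linear program is the basis $B$ of columns of this program such that the rows of $[A_B^{-1}b,\ A_B^{-1}]$ are lexicographically positive and, for each nonbasic column, increasing its variable (and adjusting the basic ones) makes the vector (cost, variables in the order of their columns) lexicographically larger. An *optimal basis* of (LP) is a basis of columns of (LP) with nonnegative basic solution $A_B^{-1}b$ and nonnegative reduced costs of all columns of (LP). **Algorithm.** Agents $1,\dots,N$ communicate over digraphs $\mathcal G(t)$, $t=0,1,2,\dots$, on $\{1,\dots,N\}$; asynchrony and packet losses are modelled by missing edges. Initially, $B^{[i]}(0)$ is the lexicographically optimal basis of the linear program whose columns are the artificial ones and those of $\alpha,\beta$, and $G_B^{[i]}(0)=B^{[i]}(0)$. In round $t$, agent $i$ does the following. 1. It collects in $G^{[i]}(t)$ the columns of $G_B^{[j]}(t)$ for $j=i$ and all in-neighbours $j$ of $i$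 in $\mathcal G(t)$. 2. It computes the lexicographically optimal basis $L$ of the linear program whose columns are those of $G^{[i]}(t)$ and those of $\alpha,\beta$, and lets $(u^{[i]}(t),v^{[i]}(t))$ be the dual vector of $L$. 3. Local greedy: it chooses an order $j_1,\dots,j_N$ of $V$ along which the entries of $u^{[i]}(t)$ are non-increasing, with $j_1=i$ if the $i$-th entry is maximal (ties are otherwise broken arbitrarily). If $j_1=i$, it generates the column $h=(0,(x,1))$ of the point $x$ with $x_{j_1}=F(\{j_1\})$ and $x_{j_\ell}=F(\{j_1,\dots,j_\ell\})-F(\{j_1,\dots,j_{\ell-1}\})$ for $\ell\ge2$; otherwise it generates no column. 4. Pivot: if $h$ was generated and has negative reduced cost with respect to $L$, then $B^{[i]}(t+1)$ arises from $L$ by replacing with $h$ the basic column selected by the lexicographic ratio test: among the basic columns with positive entry in $A_L^{-1}a_h$, where $a_h=(x,1)$, the one whose row of $[A_L^{-1}b,\ A_L^{-1}]$, divided by this entry, is lexicographically smallest. Otherwise $B^{[i]}(t+1)=L$. 5. $G_B^{[i]}(t+1)$ consists of those columns of $B^{[i]}(t+1)$ that are columns of $G$. **Theorem.** There is a constant $M_0$,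 depending only on $F$, such that for every artificial cost $M\ge M_0$ the following holds. Let $\mathcal G(t)$ be jointly strongly connected, i.e., for every $t$ the digraph with edge set $\bigcup_{\tau\ge t}\mathcal E(\tau)$ is strongly connected, where $\mathcal E(\tau)$ is the edge set of $\mathcal G(\tau)$. Then the algorithm is well defined (it generates sequences $B^{[i]}(t)$, $u^{[i]}(t)$), and for all sequences that it generates there are a round $T\in\mathbb N$, an optimal basis $B^\star$ of (LP), whose basic solution $(\theta^\star,\alpha^\star,\beta^\star)$ is an optimal solution of (LP), and a minimizer $X^\star\subseteq V$ of $F$ over all subsets of $V$, such that for all $t\ge T$ and all agents $i$ $$B^{[i]}(t)=B^\star\qquad\text{and}\qquad u^{[i]}(t)=\mathbf 1_{X^\star}.$$ -/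

import Mathlib

/-! ### Submodular functions and the base polyhedron -/

/-- A set function on the subsets of `{1, …, N}` is submodular. -/
def IsSubmodular {N : ℕ} (F : Finset (Fin N) → ℝ) : Prop :=
  ∀ A B : Finset (Fin N), F (A ∪ B) + F (A ∩ B) ≤ F A + F B

/-- The base polyhedron `B(F)`: `x(S) ≤ F(S)` for all `S`, and `x(V) = F(V)`. -/
def basePolyhedron {N : ℕ} (F : Finset (Fin N) → ℝ) : Set (Fin N → ℝ) :=
  {x | (∀ S : Finset (Fin N), ∑ l ∈ S, x l ≤ F S) ∧
    ∑ l, x l = F Finset.univ}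

/-- The vertices of the base polyhedron, i.e. the columns of the matrix `G`. -/
def vertices {N : ℕ} (F : Finset (Fin N) → ℝ) : Set (Fin N → ℝ) :=
  Set.extremePoints ℝ (basePolyhedron F)

/-- The indicator vector of a set. -/
def indicatorVec {N : ℕ} (X : Finset (Fin N)) : Fin N → ℝ :=
  fun l => if l ∈ X then 1 else 0

/-! ### The linear program over all vertices -/

/-- `(θ, α, β)` is feasible: `G θ - α + β = 0`, `1ᵀ θ = 1`, and all variables are nonnegative.
The vertices of `B(F)` are finite in number, so `θ` is a vector with one entry per vertex. -/
def LPFeasible {N : ℕ} (F : Finset (Fin N) → ℝ)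
    (θ : vertices F →₀ ℝ) (α β : Fin N → ℝ) : Prop :=
  (∀ l, (θ.sum fun x w => w * x.1 l) - α l + β l = 0) ∧
  (θ.sum fun _ w => w) = 1 ∧
  (∀ l, 0 ≤ α l) ∧ (∀ l, 0 ≤ β l) ∧ ∀ x, 0 ≤ θ x

/-- `(θ, α, β)` is an optimal solution: it minimizes `1ᵀ β` over the feasible points. -/
def LPOptimal {N : ℕ} (F : Finset (Fin N) → ℝ)
    (θ : vertices F →₀ ℝ) (α β : Fin N → ℝ) : Prop :=
  LPFeasible F θ α β ∧
  ∀ (θ' : vertices F →₀ ℝ) (α' β' : Fin N → ℝ),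
    LPFeasible F θ' α' β' → ∑ l, β l ≤ ∑ l, β' l

/-! ### Columns, bases and tableaux

All (reduced) linear programs have the form: minimize `∑ c, cost c * z c` subject to
`∑ c, z c • vec c = (0, …, 0, 1)` and `z ≥ 0`, over a set of columns. -/

/-- The columns: `gen x` belongs to a weight `θ` of a point `x ∈ ℝ^N`, `art k` to an artificial
variable, `alpha k` and `beta k` to the variables `α_k` and `β_k`. -/
inductive Col (N : ℕ) : Type where
  | gen (x : Fin N → ℝ) : Col N
  | art (k : Fin (N + 1)) : Col N
  | alpha (k : Fin N) : Col N
  | beta (k : Fin N) : Col N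

noncomputable instance Col.instDecidableEq (N : ℕ) : DecidableEq (Col N) := Classical.decEq _

/-- The coefficients of a column in the `N + 1` equality constraints; the last constraint is
`1ᵀ θ = 1`. The artificial columns are the unit vectors. -/
noncomputable def Col.vec {N : ℕ} : Col N → Fin (N + 1) → ℝ
  | .gen x => Fin.snoc (α := fun _ => ℝ) x 1
  | .art k => Pi.single k 1
  | .alpha k => - Pi.single k.castSucc 1
  | .beta k => Pi.single k.castSucc 1

/-- The cost of a column; artificial variables have the cost `M`. -/
def Col.cost {N : ℕ} (M : ℝ) : Col N → ℝ
  | .gen _ => 0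
  | .art _ => M
  | .alpha _ => 0
  | .beta _ => 1

/-- The position of a column in a linear program: first the columns of `θ` (and artificial ones),
sorted lexicographically as vectors `[cost; coefficients]`, then `α_1, …, α_N`, then
`β_1, …, β_N`. -/
noncomputable def Col.key {N : ℕ} (M : ℝ) (c : Col N) : ℕ ×ₗ Lex (Fin (N + 2) → ℝ) :=
  toLex ((match c with
      | .gen _ => 0
      | .art _ => 0
      | .alpha k => 1 + k.val
      | .beta k => 1 + N + k.val),
    toLex (Fin.cons (α := fun _ => ℝ) (c.cost M) c.vec))

/-- The columns of the variables `α` and `β`, which are present in every linear program. -/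
def slackCols (N : ℕ) : Set (Col N) :=
  Set.range Col.alpha ∪ Set.range Col.beta

/-- The columns that belong to columns of `G`. -/
def colsOfG {N : ℕ} (F : Finset (Fin N) → ℝ) : Set (Col N) :=
  Col.gen '' vertices F

/-- The right-hand side `(0, …, 0, 1)` of the equality constraints. -/
def rhs (N : ℕ) : Fin (N + 1) → ℝ := Pi.single (Fin.last N) 1

/-- `B` is a basis: `N + 1` columns with linearly independent coefficient vectors. -/
def IsBasis {N : ℕ} (B : Finset (Col N)) : Prop :=
  B.card = N + 1 ∧ LinearIndependent ℝ (fun c : B => c.1.vec)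

open Classical in
/-- The coordinates `A_B⁻¹ y` of a vector `y` with respect to a basis `B`, extended by zero to all
columns. (For a basis `B` they exist and are unique.) -/
noncomputable def coord {N : ℕ} (B : Finset (Col N)) (y : Fin (N + 1) → ℝ) : Col N → ℝ :=
  if h : ∃ z : Col N → ℝ, (∀ c, c ∉ B → z c = 0) ∧ ∑ c ∈ B, z c • c.vec = y
  then h.choose else 0

/-- The row of `[A_B⁻¹ b, A_B⁻¹]` that belongs to the basic column `c`, `b` the right-hand
side. -/
noncomputable def lexRow {N : ℕ} (B : Finset (Col N)) (c : Col N) : Fin (N + 2) → ℝ :=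
  Fin.cons (α := fun _ => ℝ) (coord B (rhs N) c) (fun k => coord B (Pi.single k 1) c)

/-- The dual vector `(u, v)ᵀ = c_Bᵀ A_B⁻¹` of a basis `B`. -/
noncomputable def dualVec {N : ℕ} (M : ℝ) (B : Finset (Col N)) : Fin (N + 1) → ℝ :=
  fun k => ∑ c ∈ B, c.cost M * coord B (Pi.single k 1) c

/-- The part `u` of the dual vector, which belongs to the constraints `G θ - α + β = 0`. -/
noncomputable def dualU {N : ℕ} (M : ℝ) (B : Finset (Col N)) : Fin N → ℝ :=
  fun k => dualVec M B k.castSucc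

/-- The reduced cost of the column `d` with respect to the basis `B`; for `d = gen x` it is
`-(uᵀ x + v)`. -/
noncomputable def redCost {N : ℕ} (M : ℝ) (B : Finset (Col N)) (d : Col N) : ℝ :=
  d.cost M - ∑ k, dualVec M B k * d.vec k

/-- The direction in which the variables move when the nonbasic variable of `d` is increased at
unit speed. -/
noncomputable def edgeDir {N : ℕ} (B : Finset (Col N)) (d : Col N) : Col N → ℝ :=
  fun c => (if c = d then 1 else 0) - coord B d.vec c

/-- `B` is the lexicographically optimal basis of the linear program with the set `C` of columns.
It is lexicographically feasible: the rows of `[A_B⁻¹ b, A_B⁻¹]` are lexicographically positive.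
And increasing a nonbasic variable makes (cost, variables in the order of `Col.key`)
lexicographically larger, so that ties in the cost are broken by the order of the columns. -/
def IsLexOptimalBasis {N : ℕ} (M : ℝ) (C : Set (Col N)) (B : Finset (Col N)) : Prop :=
  (B : Set (Col N)) ⊆ C ∧ IsBasis B ∧
  (∀ c ∈ B, toLex 0 < toLex (lexRow B c)) ∧
  ∀ d ∈ C, d ∉ B →
    0 < redCost M B d ∨
    (redCost M B d = 0 ∧
      ∃ c, 0 < edgeDir B d c ∧ ∀ c' : Col N, c'.key M < c.key M → edgeDir B d c' = 0)

/-- The result `B'` of the pivoting operation on the basis `B` and the column `h` (`none` is the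
empty column). If `h` has negative reduced cost, it replaces the basic column that is selected by
the lexicographic ratio test; otherwise the basis is kept. -/
def IsPivot {N : ℕ} (M : ℝ) (B : Finset (Col N)) (h : Option (Col N))
    (B' : Finset (Col N)) : Prop :=
  match h with
  | none => B' = B
  | some d =>
    (redCost M B d < 0 →
      ∃ c ∈ B, 0 < coord B d.vec c ∧
        (∀ c' ∈ B, 0 < coord B d.vec c' →
          toLex ((coord B d.vec c)⁻¹ • lexRow B c) ≤
            toLex ((coord B d.vec c')⁻¹ • lexRow B c')) ∧
        B' = insert d (B.erase c)) ∧
    (0 ≤ redCost M B d → B' = B)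

/-- `B` is an optimal basis of the linear program over all vertices: a basis of columns of that
program with nonnegative basic solution and nonnegative reduced costs. (None of these columns is
artificial.) -/
def IsOptimalBasis {N : ℕ} (F : Finset (Fin N) → ℝ) (M : ℝ) (B : Finset (Col N)) : Prop :=
  (B : Set (Col N)) ⊆ colsOfG F ∪ slackCols N ∧ IsBasis B ∧
  (∀ c ∈ B, 0 ≤ coord B (rhs N) c) ∧
  ∀ d ∈ colsOfG F ∪ slackCols N, 0 ≤ redCost M B d

/-- `(θ, α, β)` is the basic solution that belongs to the basis `B`. -/
def IsBasicSolution {N : ℕ} (F : Finset (Fin N) → ℝ) (B : Finset (Col N))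
    (θ : vertices F →₀ ℝ) (α β : Fin N → ℝ) : Prop :=
  (∀ x, θ x = coord B (rhs N) (.gen x.1)) ∧
  (∀ k, α k = coord B (rhs N) (.alpha k)) ∧
  (∀ k, β k = coord B (rhs N) (.beta k))

/-! ### The local greedy column generation -/

/-- `σ` (read as `j_1 = σ 0`, `j_2 = σ 1`, …) is an admissible output of the prioritized sorting
routine `Sort(u, i)`: the entries of `u` are in descending order, and `i` comes first if `u_i` is
the maximal entry. -/
def IsSort {N : ℕ} [NeZero N] (u : Fin N → ℝ) (i : Fin N) (σ : Equiv.Perm (Fin N)) : Prop :=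
  Antitone (fun l => u (σ l)) ∧ ((∀ k, u k ≤ u i) → σ 0 = i)

/-- The vertex that agent `i` computes from the order `σ`. -/
noncomputable def greedyVertex {N : ℕ} [NeZero N] (F : Finset (Fin N) → ℝ) (i : Fin N)
    (σ : Equiv.Perm (Fin N)) : Fin N → ℝ :=
  fun k =>
    if σ.symm k = 0 then F {i}
    else F ((Finset.Iic (σ.symm k)).map σ.toEmbedding) -
      F ((Finset.Iio (σ.symm k)).map σ.toEmbedding)

/-- The local greedy routine of agent `i`: a new column if `i` comes first in the order, and the
empty column otherwise. -/
noncomputable def localGreedy {N : ℕ} [NeZero N] (F : Finset (Fin N) → ℝ) (i : Fin N)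
    (σ : Equiv.Perm (Fin N)) : Option (Col N) :=
  if σ 0 = i then some (.gen (greedyVertex F i σ)) else none

/-! ### The network and the distributed algorithm -/

/-- The time-varying digraph `𝒢` is jointly strongly connected: for every `t`, the digraph with
the union of the edge sets at all times `τ ≥ t` is strongly connected. -/
def JointlyStronglyConnected {N : ℕ} (𝒢 : ℕ → Digraph (Fin N)) : Prop :=
  ∀ t : ℕ, ∀ i j : Fin N,
    Relation.ReflTransGen (fun a b => ∃ τ, t ≤ τ ∧ (𝒢 τ).Adj a b) i j

/-- The columns `G_B^{[i]}(t)` that agent `i` sends: the initial basis for `t = 0`, and afterwards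
those columns of its basis that are columns of `G`. -/
def sentCols {N : ℕ} (F : Finset (Fin N) → ℝ) (B : ℕ → Fin N → Finset (Col N))
    (t : ℕ) (i : Fin N) : Set (Col N) :=
  match t with
  | 0 => (B 0 i : Set (Col N))
  | s + 1 => (B (s + 1) i : Set (Col N)) ∩ colsOfG F

/-- The columns `G^{[i]}(t)`: the union of those sent by the in-neighbours of `i` and its own. -/
def localCols {N : ℕ} (F : Finset (Fin N) → ℝ) (𝒢 : ℕ → Digraph (Fin N))
    (B : ℕ → Fin N → Finset (Col N)) (t : ℕ) (i : Fin N) : Set (Col N) :=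
  {c | ∃ j, ((𝒢 t).Adj j i ∨ j = i) ∧ c ∈ sentCols F B t j}

/-- The bases `B^{[i]}(t)` and the dual vectors `u^{[i]}(t)` are generated by the distributed
algorithm with artificial cost `M`. The initial basis solves the linear program with the artificial
variables and `α`, `β`. In round `t`, agent `i` solves its local linear program lexicographically,
with basis `L` and dual vector `u^{[i]}(t)`, runs the local greedy routine, and pivots. -/
def IsRun {N : ℕ} [NeZero N] (F : Finset (Fin N) → ℝ) (M : ℝ) (𝒢 : ℕ → Digraph (Fin N))
    (B : ℕ → Fin N → Finset (Col N)) (u : ℕ → Fin N → Fin N → ℝ) : Prop :=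
  (∀ i, IsLexOptimalBasis M (Set.range Col.art ∪ slackCols N) (B 0 i)) ∧
  ∀ t i, ∃ (L : Finset (Col N)) (σ : Equiv.Perm (Fin N)),
    IsLexOptimalBasis M (localCols F 𝒢 B t i ∪ slackCols N) L ∧
    u t i = dualU M L ∧
    IsSort (u t i) i σ ∧
    IsPivot M L (localGreedy F i σ) (B (t + 1) i)

/-!
A basis `B` stands for a basic solution of the linear program in which the right-hand side is
perturbed by infinitesimals, with values `lexRow B`: lexicographically ordered vectors. Its quality
is the vector of its cost and its variables in the order of the columns, and `LexBetter` compares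
two such vectors lexicographically. The difference of two basic solutions is a combination of edges
of the first one with lexicographically positive weights. Hence a lexicographically optimal basis
is better than every other lexicographically feasible basis on the same columns
(`IsLexOptimalBasis.eq_or_lexBetter`), in particular it is unique, and the lexicographic ratio test
leads to a better feasible basis (`IsLexFeasible.pivot`), which also gives existence.

The initial basis consists of `β_1, …, β_N` and the last artificial column. Its dual vector is
`(1, …, 1, M)`, so for large `M` all agents put a greedy vertex into their bases in round zero.
From then on every local linear program has a feasible basis without artificial columns, and only
finitely many columns occur: the greedy vertices of the orders of `V`, and the slack columns. The
local optimal bases improve, or stay, from round to round and along every edge of the network. The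
number of better bases is a rank that can drop only finitely often, and joint strong connectivity
forces all agents to end with the same basis `L` (`exists_consensus`).

Then some agent, with a maximal entry of the common dual vector `(u, v)`, runs the greedy algorithm
and finds no column to pivot on. As the greedy vertex maximizes `u` over the base polyhedron, all
vertices price out and `L` is an optimal basis. All points in `L` are maximizers of `u`, so they are
tight on the upper level sets of `u`. If `u` had a fractional entry, the indicator vector of its
level set would give a nonzero vector on which all columns of `L` vanish; so `u` is the indicator
vector of a set `X` (`IsOptimalBasis.dualU_eq_zero_or_one`). Weak duality, against the dual points
`(1_Y, -F(Y))`, shows that `X` minimizes `F`.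
-/

/-! ### Lexicographically positive vectors -/

/-- The first nonzero entry of `v` is positive. -/
def LexPos {n : ℕ} (v : Fin n → ℝ) : Prop := toLex 0 < toLex v

lemma lexPos_iff {n : ℕ} {v : Fin n → ℝ} :
    LexPos v ↔ ∃ i, (∀ j, j < i → v j = 0) ∧ 0 < v i := by
  constructor
  · rintro ⟨i, h1, h2⟩
    exact ⟨i, fun j hj => (h1 j hj).symm, h2⟩
  · rintro ⟨i, h1, h2⟩
    exact ⟨i, fun j hj => (h1 j hj).symm, h2⟩

lemma toLex_lt_toLex_iff_lexPos {n : ℕ} {v w : Fin n → ℝ} :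
    toLex v < toLex w ↔ LexPos (w - v) := by
  unfold LexPos
  rw [toLex_sub]
  exact sub_pos.symm

lemma LexPos.ne_zero {n : ℕ} {v : Fin n → ℝ} (h : LexPos v) : v ≠ 0 := by
  rintro rfl
  exact lt_irrefl _ h

lemma LexPos.add {n : ℕ} {v w : Fin n → ℝ} (hv : LexPos v) (hw : LexPos w) :
    LexPos (v + w) := by
  unfold LexPos at *
  rw [toLex_add]
  exact add_pos hv hw

lemma LexPos.smul {n : ℕ} {v : Fin n → ℝ} (hv : LexPos v) {r : ℝ} (hr : 0 < r) :
    LexPos (r • v) := by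
  obtain ⟨i, h1, h2⟩ := lexPos_iff.1 hv
  exact lexPos_iff.2 ⟨i, fun j hj => by simp [h1 j hj], by simpa using mul_pos hr h2⟩

lemma LexPos.nonneg_zero {n : ℕ} {v : Fin (n + 1) → ℝ} (hv : LexPos v) : 0 ≤ v 0 := by
  obtain ⟨i, h1, h2⟩ := lexPos_iff.1 hv
  rcases (Fin.zero_le i).eq_or_lt with h | h
  · exact h ▸ h2.le
  · exact (h1 0 h).ge

lemma eq_zero_or_lexPos_sum {ι : Type*} {n : ℕ} (s : Finset ι) (f : ι → Fin n → ℝ)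
    (hf : ∀ i ∈ s, f i = 0 ∨ LexPos (f i)) : ∑ i ∈ s, f i = 0 ∨ LexPos (∑ i ∈ s, f i) := by
  classical
  induction s using Finset.induction_on with
  | empty => left; simp
  | insert a s ha ih =>
    rw [Finset.sum_insert ha]
    have h2 := ih fun i hi => hf i (Finset.mem_insert_of_mem hi)
    rcases hf a (Finset.mem_insert_self a s) with h1 | h1 <;> rcases h2 with h2 | h2
    · left; rw [h1, h2, add_zero]
    · right; rwa [h1, zero_add]
    · right; rwa [h2, add_zero]
    · right; exact h1.add h2

lemma lexPos_sum {ι : Type*} {n : ℕ} (s : Finset ι) (f : ι → Fin n → ℝ)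
    (hf : ∀ i ∈ s, f i = 0 ∨ LexPos (f i)) {a : ι} (ha : a ∈ s) (hpos : LexPos (f a)) :
    LexPos (∑ i ∈ s, f i) := by
  classical
  rw [← Finset.add_sum_erase s f ha]
  rcases eq_zero_or_lexPos_sum (s.erase a) f
    fun i hi => hf i (Finset.mem_of_mem_erase hi) with h | h
  · rwa [h, add_zero]
  · exact hpos.add h

/-! ### Coordinates with respect to a basis -/

lemma IsBasis.exists_coord {N : ℕ} {B : Finset (Col N)} (hB : IsBasis B)
    (y : Fin (N + 1) → ℝ) :
    ∃ z : Col N → ℝ, (∀ c, c ∉ B → z c = 0) ∧ ∑ c ∈ B, z c • c.vec = y := by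
  have hspan : Submodule.span ℝ (Set.range fun c : B => c.1.vec) = ⊤ := by
    apply hB.2.span_eq_top_of_card_eq_finrank'
    simp [hB.1]
  have hy : y ∈ Submodule.span ℝ (Set.range fun c : B => c.1.vec) := hspan ▸ Submodule.mem_top
  rw [Submodule.mem_span_range_iff_exists_fun] at hy
  obtain ⟨w, hw⟩ := hy
  refine ⟨fun c => if h : c ∈ B then w ⟨c, h⟩ else 0, fun c hc => by simp [hc], ?_⟩
  rw [← hw, ← Finset.sum_coe_sort B]
  simp

lemma coord_of_notMem {N : ℕ} {B : Finset (Col N)} (y : Fin (N + 1) → ℝ) {c : Col N}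
    (hc : c ∉ B) : coord B y c = 0 := by
  unfold coord
  split_ifs with h
  · exact h.choose_spec.1 c hc
  · rfl

lemma IsBasis.sum_coord {N : ℕ} {B : Finset (Col N)} (hB : IsBasis B) (y : Fin (N + 1) → ℝ) :
    ∑ c ∈ B, coord B y c • c.vec = y := by
  unfold coord
  rw [dif_pos (hB.exists_coord y)]
  exact (hB.exists_coord y).choose_spec.2

lemma IsBasis.coord_eq {N : ℕ} {B : Finset (Col N)} (hB : IsBasis B) {y : Fin (N + 1) → ℝ}
    {z : Col N → ℝ} (hz : ∀ c, c ∉ B → z c = 0) (hy : ∑ c ∈ B, z c • c.vec = y) :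
    coord B y = z := by
  funext c
  by_cases hc : c ∈ B
  · have h : ∑ c : B, (coord B y c.1 - z c.1) • c.1.vec = 0 := by
      rw [Finset.sum_coe_sort B fun c => (coord B y c - z c) • c.vec]
      simp only [sub_smul, Finset.sum_sub_distrib]
      rw [hB.sum_coord, hy, sub_self]
    have := Fintype.linearIndependent_iff.1 hB.2 _ h ⟨c, hc⟩
    exact sub_eq_zero.1 this
  · rw [coord_of_notMem y hc, hz c hc]

lemma isBasis_of_exists_coord {N : ℕ} {B : Finset (Col N)} (hcard : B.card = N + 1)
    (h : ∀ y : Fin (N + 1) → ℝ, ∃ z : Col N → ℝ, ∑ c ∈ B, z c • c.vec = y) : IsBasis B := by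
  refine ⟨hcard, linearIndependent_of_top_le_span_of_card_eq_finrank ?_ (by simp [hcard])⟩
  rintro y -
  obtain ⟨z, hz⟩ := h y
  rw [Submodule.mem_span_range_iff_exists_fun]
  refine ⟨fun c => z c.1, ?_⟩
  rw [← hz, ← Finset.sum_coe_sort B]

lemma IsBasis.coord_sum_smul {N : ℕ} {B : Finset (Col N)} (hB : IsBasis B) {ι : Type*}
    (s : Finset ι) (w : ι → ℝ) (y : ι → Fin (N + 1) → ℝ) (c : Col N) :
    coord B (∑ i ∈ s, w i • y i) c = ∑ i ∈ s, w i * coord B (y i) c := by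
  have := hB.coord_eq (y := ∑ i ∈ s, w i • y i) (z := fun c => ∑ i ∈ s, w i * coord B (y i) c)
    (fun c hc => by simp [coord_of_notMem _ hc]) (by
      simp only [Finset.sum_smul]
      rw [Finset.sum_comm]
      refine Finset.sum_congr rfl fun i _ => ?_
      conv_rhs => rw [← hB.sum_coord (y i)]
      simp only [Finset.smul_sum, mul_smul])
  rw [this]

lemma IsBasis.coord_eq_sum_single {N : ℕ} {B : Finset (Col N)} (hB : IsBasis B)
    (y : Fin (N + 1) → ℝ) (c : Col N) :
    coord B y c = ∑ k, y k * coord B (Pi.single k 1) c := by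
  rw [← hB.coord_sum_smul]
  congr 1
  exact pi_eq_sum_univ' y

lemma IsBasis.coord_vec_of_mem {N : ℕ} {B : Finset (Col N)} (hB : IsBasis B) {d : Col N}
    (hd : d ∈ B) (c : Col N) : coord B d.vec c = if c = d then 1 else 0 := by
  have := hB.coord_eq (y := d.vec) (z := fun c => if c = d then 1 else 0)
    (fun c hc => by rw [if_neg]; rintro rfl; exact hc hd) (by simp [hd])
  rw [this]

/-! ### Reduced costs and edge directions -/

lemma IsBasis.sum_dualVec_mul {N : ℕ} (M : ℝ) {B : Finset (Col N)} (hB : IsBasis B)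
    (y : Fin (N + 1) → ℝ) :
    ∑ k, dualVec M B k * y k = ∑ c ∈ B, c.cost M * coord B y c := by
  unfold dualVec
  simp only [Finset.sum_mul]
  rw [Finset.sum_comm]
  refine Finset.sum_congr rfl fun c _ => ?_
  rw [hB.coord_eq_sum_single y c, Finset.mul_sum]
  exact Finset.sum_congr rfl fun k _ => by ring

lemma IsBasis.redCost_eq {N : ℕ} (M : ℝ) {B : Finset (Col N)} (hB : IsBasis B) (d : Col N) :
    redCost M B d = d.cost M - ∑ c ∈ B, c.cost M * coord B d.vec c := by
  unfold redCost
  rw [hB.sum_dualVec_mul]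

lemma IsBasis.redCost_of_mem {N : ℕ} (M : ℝ) {B : Finset (Col N)} (hB : IsBasis B) {d : Col N}
    (hd : d ∈ B) : redCost M B d = 0 := by
  rw [hB.redCost_eq]
  simp [hB.coord_vec_of_mem hd, hd]

lemma IsBasis.redCost_eq_sum_edgeDir {N : ℕ} (M : ℝ) {B : Finset (Col N)} (hB : IsBasis B)
    {d : Col N} (hd : d ∉ B) :
    redCost M B d = ∑ c ∈ insert d B, c.cost M * edgeDir B d c := by
  rw [hB.redCost_eq, Finset.sum_insert hd]
  have : ∑ c ∈ B, c.cost M * edgeDir B d c = - ∑ c ∈ B, c.cost M * coord B d.vec c := by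
    rw [← Finset.sum_neg_distrib]
    refine Finset.sum_congr rfl fun c hc => ?_
    have : c ≠ d := by rintro rfl; exact hd hc
    simp [edgeDir, this]
  rw [this]
  simp [edgeDir, coord_of_notMem _ hd]
  ring

lemma edgeDir_self {N : ℕ} {B : Finset (Col N)} {d : Col N} (hd : d ∉ B) :
    edgeDir B d d = 1 := by
  simp [edgeDir, coord_of_notMem _ hd]

lemma edgeDir_of_notMem {N : ℕ} {B : Finset (Col N)} {d c : Col N} (hc : c ∉ insert d B) :
    edgeDir B d c = 0 := by
  rw [Finset.mem_insert, not_or] at hc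
  simp [edgeDir, coord_of_notMem _ hc.2, hc.1]

lemma edgeDir_of_mem {N : ℕ} {B : Finset (Col N)} {d c : Col N} (hd : d ∉ B) (hc : c ∈ B) :
    edgeDir B d c = - coord B d.vec c := by
  have : c ≠ d := by rintro rfl; exact hd hc
  simp [edgeDir, this]

/-! ### The perturbed basic solution -/

/-- The right-hand sides whose basic solutions are the entries of `lexRow`: the right-hand side of
the linear program, followed by the unit vectors. -/
def pertRhs {N : ℕ} (j : Fin (N + 2)) : Fin (N + 1) → ℝ :=
  Fin.cons (α := fun _ => Fin (N + 1) → ℝ) (rhs N) (fun k => Pi.single k 1) j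

lemma lexRow_apply {N : ℕ} (B : Finset (Col N)) (c : Col N) (j : Fin (N + 2)) :
    lexRow B c j = coord B (pertRhs j) c := by
  unfold lexRow pertRhs
  refine Fin.cases ?_ (fun k => ?_) j <;> simp

lemma lexRow_of_notMem {N : ℕ} {B : Finset (Col N)} {c : Col N} (hc : c ∉ B) :
    lexRow B c = 0 := by
  funext j
  rw [lexRow_apply, coord_of_notMem _ hc]
  rfl

lemma IsBasis.lexRow_ne_zero {N : ℕ} {B : Finset (Col N)} (hB : IsBasis B) {c : Col N}
    (hc : c ∈ B) : lexRow B c ≠ 0 := by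
  intro h
  have h1 : ∀ k, coord B (Pi.single k 1) c = 0 := fun k => by
    have := congrFun h k.succ
    simpa [lexRow] using this
  have h2 := hB.coord_vec_of_mem hc c
  rw [hB.coord_eq_sum_single] at h2
  simp [h1] at h2

/-- The cost of the perturbed basic solution: the cost row of `[A_B⁻¹ b, A_B⁻¹]`. -/
noncomputable def costRow {N : ℕ} (M : ℝ) (B : Finset (Col N)) : Fin (N + 2) → ℝ :=
  ∑ c ∈ B, c.cost M • lexRow B c

/-- A basis all of whose rows in `[A_B⁻¹ b, A_B⁻¹]` are lexicographically positive. -/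
def IsLexFeasible {N : ℕ} (B : Finset (Col N)) : Prop :=
  IsBasis B ∧ ∀ c ∈ B, LexPos (lexRow B c)

/-- The perturbed basic solution of `B` is better than that of `B'`: its cost is smaller, or the
costs agree and the first variable, in the order of the columns, in which the two solutions differ
is smaller. Both costs and variables are vectors that are compared lexicographically. -/
def LexBetter {N : ℕ} (M : ℝ) (B B' : Finset (Col N)) : Prop :=
  LexPos (costRow M B' - costRow M B) ∨
  (costRow M B' = costRow M B ∧ ∃ c, LexPos (lexRow B' c - lexRow B c) ∧
    ∀ c' : Col N, c'.key M < c.key M → lexRow B' c' = lexRow B c')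

lemma lexBetter_irrefl {N : ℕ} (M : ℝ) (B : Finset (Col N)) : ¬ LexBetter M B B := by
  rintro (h | ⟨-, c, h, -⟩)
  · exact h.ne_zero (sub_self _)
  · exact h.ne_zero (sub_self _)

lemma Col.key_injective {N : ℕ} {M : ℝ} (hM : M ≠ 0) :
    Function.Injective (Col.key M : Col N → _) := by
  have key_eq : ∀ c c' : Col N, c.key M = c'.key M →
      (ofLex (c.key M)).1 = (ofLex (c'.key M)).1 ∧ c.cost M = c'.cost M ∧ c.vec = c'.vec := by
    intro c c' h
    refine ⟨by rw [h], ?_⟩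
    have h2 : (Fin.cons (α := fun _ => ℝ) (c.cost M) c.vec : Fin (N + 2) → ℝ) =
        Fin.cons (α := fun _ => ℝ) (c'.cost M) c'.vec :=
      toLex.injective (congrArg (fun z => (ofLex z).2) h)
    exact Fin.cons_inj.1 h2
  intro c c' h
  obtain ⟨h1, h2, h3⟩ := key_eq c c' h
  cases c <;> cases c' <;> simp [Col.key, Col.cost, Col.vec] at h1 h2 h3
  case gen.gen x y =>
    rw [h3]
  case gen.art => exact absurd h2.symm hM
  case art.gen => exact absurd h2 hM
  case art.art k k' =>
    have := congrFun h3 k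
    by_cases hk : k = k'
    · rw [hk]
    · simp [hk] at this
  case alpha.alpha k k' => exact congrArg _ (Fin.ext h1)
  case beta.beta k k' => exact congrArg _ (Fin.ext h1)
  all_goals omega

lemma LexBetter.trans {N : ℕ} {M : ℝ} (hM : M ≠ 0) {B₁ B₂ B₃ : Finset (Col N)}
    (h₁ : LexBetter M B₁ B₂) (h₂ : LexBetter M B₂ B₃) : LexBetter M B₁ B₃ := by
  rcases h₁ with h₁ | ⟨h₁, c₁, hc₁, hl₁⟩ <;> rcases h₂ with h₂ | ⟨h₂, c₂, hc₂, hl₂⟩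
  · left; simpa using h₂.add h₁
  · left; rwa [h₂]
  · left; rwa [← h₁]
  · refine Or.inr ⟨h₂.trans h₁, ?_⟩
    rcases lt_trichotomy (c₁.key M) (c₂.key M) with h | h | h
    · exact ⟨c₁, by rwa [hl₂ _ h], fun c' hc' => (hl₂ _ (hc'.trans h)).trans (hl₁ _ hc')⟩
    · obtain rfl := Col.key_injective hM h
      exact ⟨c₁, by simpa using hc₂.add hc₁, fun c' hc' => (hl₂ _ hc').trans (hl₁ _ hc')⟩
    · exact ⟨c₂, by rwa [← hl₁ _ h], fun c' hc' => (hl₂ _ hc').trans (hl₁ _ (hc'.trans h))⟩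

/-! ### Lexicographic optimality -/

/-- The perturbed basic solution of `B'` arises from that of `B` by moving along the edges of its
columns outside `B`. -/
lemma IsBasis.lexRow_sub_lexRow {N : ℕ} {B B' : Finset (Col N)} (hB : IsBasis B)
    (hB' : IsBasis B') (c : Col N) :
    lexRow B' c - lexRow B c = ∑ d ∈ B' \ B, edgeDir B d c • lexRow B' d := by
  funext j
  simp only [Pi.sub_apply, Finset.sum_apply, Pi.smul_apply, smul_eq_mul, lexRow_apply]
  set y : Fin (N + 1) → ℝ := pertRhs j
  have h1 : coord B y c = ∑ d ∈ B', coord B' y d * coord B d.vec c := by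
    conv_lhs => rw [← hB'.sum_coord y]
    exact hB.coord_sum_smul _ _ _ _
  have h2 : ∑ d ∈ B' ∩ B, coord B' y d * ((if c = d then 1 else 0) - coord B d.vec c) = 0 := by
    refine Finset.sum_eq_zero fun d hd => ?_
    rw [hB.coord_vec_of_mem (Finset.mem_inter.1 hd).2]
    simp
  have h3 : ∑ d ∈ B', coord B' y d * (if c = d then 1 else 0) = coord B' y c := by
    simp only [mul_ite, mul_one, mul_zero, Finset.sum_ite_eq]
    split_ifs with h
    · rfl
    · rw [coord_of_notMem _ h]
  rw [h1, ← h3, ← Finset.sum_sub_distrib, ← Finset.sum_inter_add_sum_sdiff B' B]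
  simp only [← mul_sub]
  rw [h2, zero_add]
  exact Finset.sum_congr rfl fun d _ => mul_comm _ _

lemma IsBasis.costRow_sub_costRow {N : ℕ} (M : ℝ) {B B' : Finset (Col N)} (hB : IsBasis B)
    (hB' : IsBasis B') :
    costRow M B' - costRow M B = ∑ d ∈ B' \ B, redCost M B d • lexRow B' d := by
  have h1 : costRow M B' = ∑ c ∈ B' ∪ B, c.cost M • lexRow B' c :=
    Finset.sum_subset Finset.subset_union_left fun c _ hc => by rw [lexRow_of_notMem hc, smul_zero]
  have h2 : costRow M B = ∑ c ∈ B' ∪ B, c.cost M • lexRow B c :=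
    Finset.sum_subset Finset.subset_union_right fun c _ hc => by rw [lexRow_of_notMem hc, smul_zero]
  rw [h1, h2, ← Finset.sum_sub_distrib]
  simp only [← smul_sub, hB.lexRow_sub_lexRow hB', Finset.smul_sum]
  rw [Finset.sum_comm]
  refine Finset.sum_congr rfl fun d hd => ?_
  rw [Finset.mem_sdiff] at hd
  rw [hB.redCost_eq_sum_edgeDir M hd.2, Finset.sum_smul]
  simp only [smul_smul]
  refine (Finset.sum_subset ?_ fun c _ hc => ?_).symm
  · exact Finset.insert_subset (Finset.mem_union_left _ hd.1) Finset.subset_union_right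
  · rw [edgeDir_of_notMem hc, mul_zero, zero_smul]

lemma IsLexOptimalBasis.isLexFeasible {N : ℕ} {M : ℝ} {C : Set (Col N)} {L : Finset (Col N)}
    (hL : IsLexOptimalBasis M C L) : IsLexFeasible L := ⟨hL.2.1, hL.2.2.1⟩

lemma IsLexOptimalBasis.redCost_nonneg {N : ℕ} {M : ℝ} {C : Set (Col N)} {L : Finset (Col N)}
    (hL : IsLexOptimalBasis M C L) {d : Col N} (hd : d ∈ C) : 0 ≤ redCost M L d := by
  by_cases h : d ∈ L
  · exact (hL.2.1.redCost_of_mem M h).ge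
  · rcases hL.2.2.2 d hd h with h | h
    · exact h.le
    · exact h.1.ge

/-- A lexicographically optimal basis is better than every other lexicographically feasible one. -/
lemma IsLexOptimalBasis.eq_or_lexBetter {N : ℕ} {M : ℝ} (hM : M ≠ 0) {C : Set (Col N)}
    {L B : Finset (Col N)} (hL : IsLexOptimalBasis M C L) (hB : IsLexFeasible B)
    (hBC : (B : Set (Col N)) ⊆ C) : B = L ∨ LexBetter M L B := by
  have hLb := hL.2.1
  by_cases hsub : B ⊆ L
  · left
    exact Finset.eq_of_subset_of_card_le hsub (by rw [hLb.1, hB.1.1])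
  right
  have hne : (B \ L).Nonempty := Finset.sdiff_nonempty.2 hsub
  have hpos : ∀ d ∈ B \ L, LexPos (lexRow B d) := fun d hd => hB.2 d (Finset.mem_sdiff.1 hd).1
  have hC : ∀ d ∈ B \ L, d ∈ C := fun d hd => hBC (Finset.mem_sdiff.1 hd).1
  have hsmul : ∀ d ∈ B \ L, ∀ r : ℝ, 0 ≤ r → r • lexRow B d = 0 ∨ LexPos (r • lexRow B d) := by
    intro d hd r hr
    rcases hr.eq_or_lt with h | h
    · left; rw [← h, zero_smul]
    · right; exact (hpos d hd).smul h
  by_cases hex : ∃ d ∈ B \ L, 0 < redCost M L d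
  · obtain ⟨d, hd, hdpos⟩ := hex
    left
    rw [hLb.costRow_sub_costRow M hB.1]
    exact lexPos_sum _ _ (fun e he => hsmul e he _ (hL.redCost_nonneg (hC e he))) hd
      ((hpos d hd).smul hdpos)
  right
  push Not at hex
  have hzero : ∀ d ∈ B \ L, redCost M L d = 0 :=
    fun d hd => le_antisymm (hex d hd) (hL.redCost_nonneg (hC d hd))
  have hwit : ∀ d, ∃ c, d ∈ B \ L →
      (0 < edgeDir L d c ∧ ∀ c' : Col N, c'.key M < c.key M → edgeDir L d c' = 0) := by
    intro d
    by_cases hd : d ∈ B \ L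
    · rcases hL.2.2.2 d (hC d hd) (Finset.mem_sdiff.1 hd).2 with h | ⟨-, c, hc⟩
      · exact absurd (hzero d hd) h.ne'
      · exact ⟨c, fun _ => hc⟩
    · exact ⟨d, fun h => absurd h hd⟩
  choose w hw using hwit
  -- `w d` is the first variable that the edge of `d` changes; compare at the first of all of these
  obtain ⟨d₀, hd₀, hmin⟩ := Finset.exists_min_image (B \ L) (fun d => (w d).key M) hne
  refine ⟨?_, w d₀, ?_, fun c' hc' => ?_⟩
  · rw [← sub_eq_zero, hLb.costRow_sub_costRow M hB.1]
    exact Finset.sum_eq_zero fun d hd => by rw [hzero d hd, zero_smul]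
  · rw [hLb.lexRow_sub_lexRow hB.1]
    refine lexPos_sum _ _ (fun d hd => hsmul d hd _ ?_) hd₀ ((hpos d₀ hd₀).smul (hw d₀ hd₀).1)
    rcases (hmin d hd).eq_or_lt with h | h
    · rw [Col.key_injective hM h]
      exact (hw d hd).1.le
    · exact ((hw d hd).2 _ h).ge
  · rw [← sub_eq_zero, hLb.lexRow_sub_lexRow hB.1]
    exact Finset.sum_eq_zero fun d hd => by
      rw [(hw d hd).2 c' (hc'.trans_le (hmin d hd)), zero_smul]

lemma IsLexOptimalBasis.unique {N : ℕ} {M : ℝ} (hM : M ≠ 0) {C : Set (Col N)}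
    {L L' : Finset (Col N)} (hL : IsLexOptimalBasis M C L) (hL' : IsLexOptimalBasis M C L') :
    L = L' := by
  rcases hL.eq_or_lexBetter hM hL'.isLexFeasible hL'.1 with h | h
  · exact h.symm
  rcases hL'.eq_or_lexBetter hM hL.isLexFeasible hL.1 with h' | h'
  · exact h'
  exact absurd (h.trans hM h') (lexBetter_irrefl M L)

/-! ### Pivoting -/

lemma sum_edgeDir_smul_vec {N : ℕ} {B : Finset (Col N)} (hB : IsBasis B) {d : Col N}
    (hd : d ∉ B) : ∑ c ∈ insert d B, edgeDir B d c • c.vec = 0 := by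
  rw [Finset.sum_insert hd, edgeDir_self hd, one_smul]
  have : ∑ c ∈ B, edgeDir B d c • c.vec = - ∑ c ∈ B, coord B d.vec c • c.vec := by
    rw [← Finset.sum_neg_distrib]
    exact Finset.sum_congr rfl fun c hc => by rw [edgeDir_of_mem hd hc, neg_smul]
  rw [this, hB.sum_coord, add_neg_cancel]

/-- Adding a multiple of the edge of `d` to the coordinates with respect to `B` eliminates `c`. -/
lemma IsBasis.exchange {N : ℕ} {B : Finset (Col N)} (hB : IsBasis B) {d c : Col N}
    (hd : d ∉ B) (hc : c ∈ B) (hne : coord B d.vec c ≠ 0) :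
    IsBasis (insert d (B.erase c)) := by
  have hcd : c ≠ d := by rintro rfl; exact hd hc
  have hd' : d ∉ B.erase c := fun h => hd (Finset.mem_of_mem_erase h)
  refine isBasis_of_exists_coord ?_ fun y => ?_
  · rw [Finset.card_insert_of_notMem hd', Finset.card_erase_of_mem hc, hB.1]
    simp
  · refine ⟨fun e => coord B y e + coord B y c / coord B d.vec c * edgeDir B d e, ?_⟩
    have h1 : insert d (B.erase c) = (insert d B).erase c := by
      rw [Finset.erase_insert_of_ne hcd.symm]
    rw [h1, Finset.sum_erase]
    · simp only [add_smul, mul_smul, Finset.sum_add_distrib]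
      rw [← Finset.smul_sum, sum_edgeDir_smul_vec hB hd, smul_zero, add_zero,
        Finset.sum_insert hd, coord_of_notMem _ hd, zero_smul, zero_add, hB.sum_coord]
    · beta_reduce
      rw [edgeDir_of_mem hd hc, mul_neg, div_mul_cancel₀ _ hne, add_neg_cancel, zero_smul]

/-- Increasing the variable of the nonbasic column `d` makes the vector (cost, variables in the
order of the columns) lexicographically smaller. -/
def IsImproving {N : ℕ} (M : ℝ) (B : Finset (Col N)) (d : Col N) : Prop :=
  redCost M B d < 0 ∨ (redCost M B d = 0 ∧
    ∃ c, edgeDir B d c < 0 ∧ ∀ c' : Col N, c'.key M < c.key M → edgeDir B d c' = 0)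

/-- Exchanging an improving column for the one selected by the lexicographic ratio test leads to a
better lexicographically feasible basis. -/
lemma IsLexFeasible.pivot {N : ℕ} {M : ℝ} {B : Finset (Col N)} (hB : IsLexFeasible B)
    {d c : Col N} (hd : d ∉ B) (hc : c ∈ B) (hpos : 0 < coord B d.vec c)
    (hmin : ∀ c' ∈ B, 0 < coord B d.vec c' →
      toLex ((coord B d.vec c)⁻¹ • lexRow B c) ≤ toLex ((coord B d.vec c')⁻¹ • lexRow B c'))
    (himp : IsImproving M B d) :
    IsLexFeasible (insert d (B.erase c)) ∧ LexBetter M (insert d (B.erase c)) B := by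
  have hB' := hB.1.exchange hd hc hpos.ne'
  set B' := insert d (B.erase c) with hB'def
  have hcd : c ≠ d := by rintro rfl; exact hd hc
  have hcB' : c ∉ B' := by simp [hB'def, hcd]
  have hdB' : d ∈ B' := by simp [hB'def]
  have hdiff : B' \ B = {d} := by
    ext e
    simp only [hB'def, Finset.mem_sdiff, Finset.mem_insert, Finset.mem_erase,
      Finset.mem_singleton]
    constructor
    · rintro ⟨h | h, h'⟩
      · exact h
      · exact absurd h.2 h'
    · rintro rfl
      exact ⟨Or.inl rfl, hd⟩
  have hrow : ∀ e, lexRow B' e - lexRow B e = edgeDir B d e • lexRow B' d := fun e => by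
    rw [hB.1.lexRow_sub_lexRow hB', hdiff, Finset.sum_singleton]
  have hcost : costRow M B' - costRow M B = redCost M B d • lexRow B' d := by
    rw [hB.1.costRow_sub_costRow M hB', hdiff, Finset.sum_singleton]
  -- the row of the entering column is the minimal ratio
  have hd_row : lexRow B' d = (coord B d.vec c)⁻¹ • lexRow B c := by
    have := hrow c
    rw [lexRow_of_notMem hcB', edgeDir_of_mem hd hc, zero_sub, neg_smul, neg_inj] at this
    rw [this, inv_smul_smul₀ hpos.ne']
  have hd_pos : LexPos (lexRow B' d) := by
    rw [hd_row]
    exact (hB.2 c hc).smul (inv_pos.2 hpos)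
  refine ⟨⟨hB', fun e he => ?_⟩, ?_⟩
  · by_cases hed : e = d
    · rwa [hed]
    have heB : e ∈ B := by
      rw [hB'def, Finset.mem_insert, Finset.mem_erase] at he
      exact (he.resolve_left hed).2
    have hre : lexRow B' e = lexRow B e - coord B d.vec e • lexRow B' d := by
      have := hrow e
      rw [edgeDir_of_mem hd heB, neg_smul, sub_eq_iff_eq_add] at this
      rw [this]
      abel
    rcases lt_trichotomy (coord B d.vec e) 0 with h | h | h
    · rw [hre, sub_eq_add_neg, ← neg_smul]
      exact (hB.2 e heB).add (hd_pos.smul (neg_pos.2 h))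
    · rw [hre, h, zero_smul, sub_zero]
      exact hB.2 e heB
    · -- the ratio test makes the row nonnegative, and a row of an inverse matrix is nonzero
      rcases (hmin e heB h).eq_or_lt with h1 | h1
      · exfalso
        apply hB'.lexRow_ne_zero he
        rw [hre, hd_row, toLex.injective h1, smul_inv_smul₀ h.ne', sub_self]
      · have := (toLex_lt_toLex_iff_lexPos.1 h1).smul h
        rwa [smul_sub, smul_inv_smul₀ h.ne', ← hd_row, ← hre] at this
  · rcases himp with h | ⟨h, e, he, hlow⟩
    · left
      rw [← neg_sub, hcost, ← neg_smul]
      exact hd_pos.smul (neg_pos.2 h)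
    · right
      refine ⟨?_, e, ?_, fun e' he' => ?_⟩
      · rw [h, zero_smul, sub_eq_zero] at hcost
        exact hcost.symm
      · rw [← neg_sub, hrow, ← neg_smul]
        exact hd_pos.smul (neg_pos.2 he)
      · have := hrow e'
        rw [hlow e' he', zero_smul, sub_eq_zero] at this
        exact this.symm

/-- With nonnegative costs no edge is both improving and unbounded, so the ratio test selects a
column. -/
lemma IsImproving.exists_ratio_test {N : ℕ} {M : ℝ} (hM : 0 ≤ M) {B : Finset (Col N)}
    (hB : IsBasis B) {d : Col N} (hd : d ∉ B) (himp : IsImproving M B d) :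
    ∃ c ∈ B, 0 < coord B d.vec c ∧ ∀ c' ∈ B, 0 < coord B d.vec c' →
      toLex ((coord B d.vec c)⁻¹ • lexRow B c) ≤
        toLex ((coord B d.vec c')⁻¹ • lexRow B c') := by
  have hex : ∃ c ∈ B, 0 < coord B d.vec c := by
    by_contra! hcon
    have hnn : ∀ c, 0 ≤ edgeDir B d c := by
      intro c
      by_cases hc : c ∈ B
      · rw [edgeDir_of_mem hd hc]
        exact neg_nonneg.2 (hcon c hc)
      · by_cases hcd : c = d
        · rw [hcd, edgeDir_self hd]
          exact zero_le_one
        · rw [edgeDir_of_notMem (by simp [hc, hcd])]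
    rcases himp with h | ⟨-, c, hc, -⟩
    · refine h.not_ge ?_
      rw [hB.redCost_eq_sum_edgeDir M hd]
      refine Finset.sum_nonneg fun c _ => mul_nonneg ?_ (hnn c)
      cases c <;> simp [Col.cost, hM]
    · exact hc.not_ge (hnn c)
  obtain ⟨c₀, hc₀, hpos₀⟩ := hex
  obtain ⟨c, hc, hmin⟩ := Finset.exists_min_image (B.filter fun c => 0 < coord B d.vec c)
    (fun c => toLex ((coord B d.vec c)⁻¹ • lexRow B c)) ⟨c₀, by simp [hc₀, hpos₀]⟩
  rw [Finset.mem_filter] at hc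
  exact ⟨c, hc.1, hc.2, fun c' hc' hpos' => hmin c' (by simp [hc', hpos'])⟩

/-! ### Existence of lexicographically optimal bases -/

/-- A feasible basis for which no better one exists is optimal: any improving column could be
pivoted in. -/
lemma exists_isLexOptimalBasis {N : ℕ} {M : ℝ} (hM : 0 < M) {C : Set (Col N)} (hC : C.Finite)
    {B₀ : Finset (Col N)} (hB₀ : IsLexFeasible B₀) (hB₀C : (B₀ : Set (Col N)) ⊆ C) :
    ∃ L, IsLexOptimalBasis M C L := by
  set S : Set (Finset (Col N)) := {B | (B : Set (Col N)) ⊆ C ∧ IsLexFeasible B} with hS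
  have hfin : S.Finite := by
    refine (Set.Finite.finite_subsets hC).preimage (f := fun B : Finset (Col N) => (B : Set (Col N)))
      (Finset.coe_injective.injOn) |>.subset ?_
    exact fun B hB => hB.1
  have : IsStrictOrder (Finset (Col N)) (LexBetter M) :=
    { irrefl := lexBetter_irrefl M
      trans := fun _ _ _ h h' => h.trans hM.ne' h' }
  have hwf : S.WellFoundedOn (LexBetter M) := hfin.wellFoundedOn
  obtain ⟨⟨L, hLS⟩, -, hmin⟩ := hwf.has_min Set.univ ⟨⟨B₀, hB₀C, hB₀⟩, trivial⟩
  refine ⟨L, hLS.1, hLS.2.1, hLS.2.2, fun d hdC hd => ?_⟩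
  by_contra hcon
  rw [not_or] at hcon
  have himp : IsImproving M L d := by
    rcases (not_lt.1 hcon.1).lt_or_eq with h | h
    · exact Or.inl h
    · refine Or.inr ⟨h, ?_⟩
      obtain ⟨c, hc, hcmin⟩ := Finset.exists_min_image
        ((insert d L).filter fun c => edgeDir L d c ≠ 0) (Col.key M)
        ⟨d, by simp [edgeDir_self hd]⟩
      rw [Finset.mem_filter] at hc
      have hlow : ∀ c' : Col N, c'.key M < c.key M → edgeDir L d c' = 0 := by
        intro c' hc'
        by_contra hne
        refine hc'.not_ge (hcmin c' (Finset.mem_filter.2 ⟨?_, hne⟩))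
        by_contra hmem
        exact hne (edgeDir_of_notMem hmem)
      refine ⟨c, ?_, hlow⟩
      rcases hc.2.lt_or_gt with h' | h'
      · exact h'
      · exact absurd ⟨h, c, h', hlow⟩ hcon.2
  obtain ⟨c, hc, hpos, hratio⟩ := himp.exists_ratio_test hM.le hLS.2.1 hd
  obtain ⟨h1, h2⟩ := hLS.2.pivot hd hc hpos hratio himp
  refine hmin ⟨insert d (L.erase c), ?_, h1⟩ trivial h2
  intro e he
  rw [Finset.mem_coe, Finset.mem_insert, Finset.mem_erase] at he
  rcases he with rfl | he
  · exact hdC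
  · exact hLS.1 he.2

/-! ### The pivoting operation of the algorithm -/

lemma IsImproving.of_redCost_neg {N : ℕ} {M : ℝ} {B : Finset (Col N)} {d : Col N}
    (h : redCost M B d < 0) : IsImproving M B d := Or.inl h

lemma IsBasis.notMem_of_redCost_neg {N : ℕ} {M : ℝ} {B : Finset (Col N)} (hB : IsBasis B)
    {d : Col N} (h : redCost M B d < 0) : d ∉ B :=
  fun hd => h.ne (hB.redCost_of_mem M hd)

lemma exists_isPivot {N : ℕ} {M : ℝ} (hM : 0 ≤ M) {L : Finset (Col N)} (hL : IsBasis L)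
    (h : Option (Col N)) : ∃ B', IsPivot M L h B' := by
  rcases h with _ | d
  · exact ⟨L, rfl⟩
  · by_cases hd : redCost M L d < 0
    · obtain ⟨c, hc, hpos, hmin⟩ := (IsImproving.of_redCost_neg hd).exists_ratio_test hM hL
        (hL.notMem_of_redCost_neg hd)
      exact ⟨_, fun _ => ⟨c, hc, hpos, hmin, rfl⟩, fun h => absurd hd h.not_gt⟩
    · exact ⟨L, fun h => absurd h hd, fun _ => rfl⟩

/-- A pivot either keeps the basis, and then no column with negative reduced cost was proposed,
or it exchanges one column and yields a better lexicographically feasible basis. -/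
lemma IsPivot.cases {N : ℕ} {M : ℝ} {L B' : Finset (Col N)} {h : Option (Col N)}
    (hp : IsPivot M L h B') (hL : IsLexFeasible L) :
    (B' = L ∧ ∀ d, h = some d → 0 ≤ redCost M L d) ∨
    (IsLexFeasible B' ∧ LexBetter M B' L ∧ ∃ d, h = some d ∧ d ∈ B' ∧ B' ⊆ insert d L) := by
  rcases h with _ | d
  · exact Or.inl ⟨hp, by simp⟩
  · rcases lt_or_ge (redCost M L d) 0 with hd | hd
    · obtain ⟨c, hc, hpos, hmin, rfl⟩ := hp.1 hd
      have := hL.pivot (hL.1.notMem_of_redCost_neg hd) hc hpos hmin (.of_redCost_neg hd)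
      exact Or.inr ⟨this.1, this.2, d, rfl, Finset.mem_insert_self _ _,
        Finset.insert_subset_insert _ (Finset.erase_subset _ _)⟩
    · refine Or.inl ⟨hp.2 hd, ?_⟩
      rintro _ ⟨⟩
      exact hd

/-! ### Reduced costs of the individual columns -/

lemma redCost_alpha {N : ℕ} (M : ℝ) (B : Finset (Col N)) (k : Fin N) :
    redCost M B (.alpha k) = dualU M B k := by
  simp [redCost, Col.cost, Col.vec, dualU, Pi.single_apply]

lemma redCost_beta {N : ℕ} (M : ℝ) (B : Finset (Col N)) (k : Fin N) :
    redCost M B (.beta k) = 1 - dualU M B k := by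
  simp [redCost, Col.cost, Col.vec, dualU, Pi.single_apply]

lemma redCost_art {N : ℕ} (M : ℝ) (B : Finset (Col N)) (k : Fin (N + 1)) :
    redCost M B (.art k) = M - dualVec M B k := by
  simp [redCost, Col.cost, Col.vec, Pi.single_apply]

lemma redCost_gen {N : ℕ} (M : ℝ) (B : Finset (Col N)) (x : Fin N → ℝ) :
    redCost M B (.gen x) = -(∑ k, dualU M B k * x k + dualVec M B (Fin.last N)) := by
  simp [redCost, Col.cost, Col.vec, dualU, Fin.sum_univ_castSucc]

/-! ### Bases of one column and slack columns -/

/-- The slack column of the constraint `k` that is nonnegative in the basic solution with weight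
one on the column `p`. -/
noncomputable def slackOf {N : ℕ} (p : Col N) (k : Fin N) : Col N :=
  if 0 < p.vec k.castSucc then .alpha k else .beta k

/-- The basis of `p` and one slack column per constraint. -/
noncomputable def slackBasis {N : ℕ} (p : Col N) : Finset (Col N) :=
  insert p (Finset.univ.image (slackOf p))

/-- The coordinates of `y` with respect to `slackBasis p`. -/
noncomputable def slackCoord {N : ℕ} (p : Col N) (y : Fin (N + 1) → ℝ) : Col N → ℝ
  | .alpha k => if 0 < p.vec k.castSucc
      then p.vec k.castSucc * y (Fin.last N) - y k.castSucc else 0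
  | .beta k => if 0 < p.vec k.castSucc
      then 0 else y k.castSucc - p.vec k.castSucc * y (Fin.last N)
  | c => if c = p then y (Fin.last N) else 0

lemma slackOf_injective {N : ℕ} (p : Col N) : Function.Injective (slackOf p) := by
  intro k l h
  unfold slackOf at h
  split_ifs at h <;> simpa using h

lemma vec_last_of_mem_slackCols {N : ℕ} {c : Col N} (hc : c ∈ slackCols N) :
    c.vec (Fin.last N) = 0 := by
  rcases hc with ⟨k, rfl⟩ | ⟨k, rfl⟩ <;> simp [Col.vec]

lemma slackOf_mem_slackCols {N : ℕ} (p : Col N) (k : Fin N) : slackOf p k ∈ slackCols N := by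
  unfold slackOf
  split_ifs
  · exact Or.inl ⟨k, rfl⟩
  · exact Or.inr ⟨k, rfl⟩

lemma slackBasis_subset {N : ℕ} {p : Col N} {C : Set (Col N)} (hp : p ∈ C)
    (hC : slackCols N ⊆ C) : (slackBasis p : Set (Col N)) ⊆ C := by
  intro c hc
  simp only [slackBasis, Finset.coe_insert, Finset.coe_image, Finset.coe_univ, Set.image_univ,
    Set.mem_insert_iff, Set.mem_range] at hc
  rcases hc with rfl | ⟨k, rfl⟩
  · exact hp
  · exact hC (slackOf_mem_slackCols p k)

lemma notMem_image_slackOf {N : ℕ} {p : Col N} (hp : p.vec (Fin.last N) = 1) :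
    p ∉ Finset.univ.image (slackOf p) := by
  simp only [Finset.mem_image, Finset.mem_univ, true_and, not_exists]
  intro k hk
  have := vec_last_of_mem_slackCols (slackOf_mem_slackCols p k)
  rw [hk, hp] at this
  exact one_ne_zero this

lemma slackCoord_self {N : ℕ} {p : Col N} (hp : p.vec (Fin.last N) = 1)
    (y : Fin (N + 1) → ℝ) : slackCoord p y p = y (Fin.last N) := by
  cases p <;> simp [slackCoord, Col.vec] at hp ⊢

lemma sum_slackCoord {N : ℕ} {p : Col N} (hp : p.vec (Fin.last N) = 1)
    (y : Fin (N + 1) → ℝ) : ∑ c ∈ slackBasis p, slackCoord p y c • c.vec = y := by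
  have h : ∀ k, slackCoord p y (slackOf p k) • (slackOf p k).vec =
      (y k.castSucc - p.vec k.castSucc * y (Fin.last N)) •
        (Pi.single k.castSucc 1 : Fin (N + 1) → ℝ) := by
    intro k
    by_cases hk : 0 < p.vec k.castSucc
    · have hs : slackOf p k = .alpha k := if_pos hk
      rw [hs, show (Col.alpha k).vec = -Pi.single k.castSucc 1 from rfl, slackCoord, if_pos hk,
        smul_neg, ← neg_smul, neg_sub]
    · have hs : slackOf p k = .beta k := if_neg hk
      rw [hs, show (Col.beta k).vec = Pi.single k.castSucc 1 from rfl, slackCoord, if_neg hk]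
  rw [slackBasis, Finset.sum_insert (notMem_image_slackOf hp),
    Finset.sum_image (slackOf_injective p).injOn, slackCoord_self hp]
  simp only [h]
  funext l
  refine Fin.lastCases ?_ (fun l => ?_) l
  · simp [hp]
  · simp [Pi.single_apply]
    ring

lemma isBasis_slackBasis {N : ℕ} {p : Col N} (hp : p.vec (Fin.last N) = 1) :
    IsBasis (slackBasis p) := by
  refine isBasis_of_exists_coord ?_ fun y => ⟨slackCoord p y, sum_slackCoord hp y⟩
  rw [slackBasis, Finset.card_insert_of_notMem (notMem_image_slackOf hp),
    Finset.card_image_of_injective _ (slackOf_injective p), Finset.card_univ, Fintype.card_fin]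

lemma coord_slackBasis {N : ℕ} {p : Col N} (hp : p.vec (Fin.last N) = 1)
    (y : Fin (N + 1) → ℝ) : coord (slackBasis p) y = slackCoord p y := by
  refine (isBasis_slackBasis hp).coord_eq (fun c hc => ?_) (sum_slackCoord hp y)
  simp only [slackBasis, Finset.mem_insert, Finset.mem_image, Finset.mem_univ, true_and,
    not_or, not_exists] at hc
  cases c with
  | gen x => simp [slackCoord, hc.1]
  | art k => simp [slackCoord, hc.1]
  | alpha k =>
    have := hc.2 k
    by_cases hk : 0 < p.vec k.castSucc
    · simp [slackOf, hk] at this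
    · simp [slackCoord, hk]
  | beta k =>
    have := hc.2 k
    by_cases hk : 0 < p.vec k.castSucc
    · simp [slackCoord, hk]
    · simp [slackOf, hk] at this

/-- The choice of the slack columns makes the entries for the right-hand side nonnegative; where one
vanishes, the slack column is `β_k`, and its row continues with the positive entry of `e_k`. -/
lemma isLexFeasible_slackBasis {N : ℕ} {p : Col N} (hp : p.vec (Fin.last N) = 1) :
    IsLexFeasible (slackBasis p) := by
  refine ⟨isBasis_slackBasis hp, fun c hc => lexPos_iff.2 ?_⟩
  have hrow : ∀ c, lexRow (slackBasis p) c 0 = slackCoord p (rhs N) c := fun c => by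
    rw [lexRow_apply, coord_slackBasis hp]
    rfl
  have hrow' : ∀ c (k : Fin (N + 1)),
      lexRow (slackBasis p) c k.succ = slackCoord p (Pi.single k 1) c := fun c k => by
    rw [lexRow_apply, coord_slackBasis hp]
    rfl
  simp only [slackBasis, Finset.mem_insert, Finset.mem_image, Finset.mem_univ, true_and] at hc
  rcases hc with rfl | ⟨k, rfl⟩
  · refine ⟨0, fun j hj => absurd hj (Fin.not_lt_zero j), ?_⟩
    rw [hrow, slackCoord_self hp]
    simp [rhs]
  · rcases lt_trichotomy 0 (p.vec k.castSucc) with hk | hk | hk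
    · refine ⟨0, fun j hj => absurd hj (Fin.not_lt_zero j), ?_⟩
      rw [hrow]
      simp [slackOf, hk, slackCoord, rhs]
    · have hs : slackOf p k = .beta k := by simp [slackOf, ← hk]
      refine ⟨k.castSucc.succ, fun j hj => ?_, ?_⟩
      · rw [hs]
        induction j using Fin.cases with
        | zero => simp [hrow, slackCoord, ← hk, rhs]
        | succ m =>
          have hm : k.castSucc ≠ m := (Fin.succ_lt_succ_iff.1 hj).ne'
          simp [hrow', slackCoord, ← hk, Pi.single_apply, hm]
      · rw [hs]
        simp [hrow', slackCoord, ← hk]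
    · refine ⟨0, fun j hj => absurd hj (Fin.not_lt_zero j), ?_⟩
      rw [hrow]
      simp [slackOf, hk.not_gt, slackCoord, rhs, hk]

/-! ### The initial basis -/

/-- The initial basis: `β_1, …, β_N` and the artificial column of the last constraint. -/
noncomputable def initBasis (N : ℕ) : Finset (Col N) := slackBasis (.art (Fin.last N))

lemma vec_art_last (N : ℕ) : (Col.art (Fin.last N) : Col N).vec (Fin.last N) = 1 := by
  simp [Col.vec]

lemma beta_mem_initBasis {N : ℕ} (k : Fin N) : Col.beta k ∈ initBasis N := by
  have : slackOf (.art (Fin.last N)) k = .beta k := by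
    simp [slackOf, Col.vec]
  rw [initBasis, slackBasis, ← this]
  exact Finset.mem_insert_of_mem (Finset.mem_image_of_mem _ (Finset.mem_univ _))

lemma art_mem_initBasis (N : ℕ) : Col.art (Fin.last N) ∈ initBasis N :=
  Finset.mem_insert_self _ _

lemma isLexFeasible_initBasis (N : ℕ) : IsLexFeasible (initBasis N) :=
  isLexFeasible_slackBasis (vec_art_last N)

lemma dualU_initBasis {N : ℕ} (M : ℝ) (k : Fin N) : dualU M (initBasis N) k = 1 := by
  have := (isLexFeasible_initBasis N).1.redCost_of_mem M (beta_mem_initBasis k)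
  rw [redCost_beta] at this
  linarith

lemma dualVec_last_initBasis (N : ℕ) (M : ℝ) : dualVec M (initBasis N) (Fin.last N) = M := by
  have := (isLexFeasible_initBasis N).1.redCost_of_mem M (art_mem_initBasis N)
  rw [redCost_art] at this
  linarith

lemma isLexOptimalBasis_initBasis {N : ℕ} {M : ℝ} (hM : 1 < M) {C : Set (Col N)}
    (hC : C ⊆ Set.range Col.art ∪ slackCols N) (hmem : (initBasis N : Set (Col N)) ⊆ C) :
    IsLexOptimalBasis M C (initBasis N) := by
  refine ⟨hmem, (isLexFeasible_initBasis N).1, (isLexFeasible_initBasis N).2,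
    fun d hd hd' => Or.inl ?_⟩
  rcases hC hd with ⟨k, rfl⟩ | ⟨k, rfl⟩ | ⟨k, rfl⟩
  · rw [redCost_art]
    induction k using Fin.lastCases with
    | last => exact absurd (art_mem_initBasis N) hd'
    | cast k =>
      have := dualU_initBasis M k
      unfold dualU at this
      linarith
  · rw [redCost_alpha, dualU_initBasis]
    exact one_pos
  · exact absurd (beta_mem_initBasis k) hd'

lemma initBasis_subset (N : ℕ) :
    (initBasis N : Set (Col N)) ⊆ Set.range Col.art ∪ slackCols N :=
  slackBasis_subset (Or.inl ⟨_, rfl⟩) Set.subset_union_right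

/-! ### The greedy vertices of the base polyhedron -/

/-- The first `m` elements of the order `σ`. -/
def prefixSet {N : ℕ} (σ : Equiv.Perm (Fin N)) (m : ℕ) : Finset (Fin N) :=
  Finset.univ.filter fun k => (σ.symm k).val < m

lemma mem_prefixSet {N : ℕ} {σ : Equiv.Perm (Fin N)} {m : ℕ} {k : Fin N} :
    k ∈ prefixSet σ m ↔ (σ.symm k).val < m := by simp [prefixSet]

lemma prefixSet_zero {N : ℕ} (σ : Equiv.Perm (Fin N)) : prefixSet σ 0 = ∅ := by
  ext k; simp [mem_prefixSet]

lemma prefixSet_self {N : ℕ} (σ : Equiv.Perm (Fin N)) : prefixSet σ N = Finset.univ := by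
  ext k; simp [mem_prefixSet]

lemma prefixSet_succ {N : ℕ} (σ : Equiv.Perm (Fin N)) (l : Fin N) :
    prefixSet σ (l + 1) = insert (σ l) (prefixSet σ l) := by
  ext k
  rw [Finset.mem_insert, mem_prefixSet, mem_prefixSet, Nat.lt_succ_iff_lt_or_eq, or_comm,
    ← Fin.ext_iff, Equiv.symm_apply_eq]

lemma notMem_prefixSet {N : ℕ} (σ : Equiv.Perm (Fin N)) (l : Fin N) : σ l ∉ prefixSet σ l := by
  simp [mem_prefixSet]

/-- The point that the greedy algorithm generates from the order `σ`. -/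
def greedyPoint {N : ℕ} (F : Finset (Fin N) → ℝ) (σ : Equiv.Perm (Fin N)) : Fin N → ℝ :=
  fun k => F (prefixSet σ (σ.symm k + 1)) - F (prefixSet σ (σ.symm k))

lemma greedyVertex_eq_greedyPoint {N : ℕ} [NeZero N] {F : Finset (Fin N) → ℝ} (hF₀ : F ∅ = 0)
    {i : Fin N} {σ : Equiv.Perm (Fin N)} (hσ : σ 0 = i) :
    greedyVertex F i σ = greedyPoint F σ := by
  funext k
  have h1 : ∀ l : Fin N, (Finset.Iic l).map σ.toEmbedding = prefixSet σ (l + 1) := by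
    intro l
    ext k
    rw [Finset.mem_map_equiv, mem_prefixSet, Finset.mem_Iic, Nat.lt_succ_iff, Fin.le_def]
  have h2 : ∀ l : Fin N, (Finset.Iio l).map σ.toEmbedding = prefixSet σ l := by
    intro l
    ext k
    rw [Finset.mem_map_equiv, mem_prefixSet, Finset.mem_Iio, Fin.lt_def]
  unfold greedyVertex greedyPoint
  rw [h1, h2]
  split_ifs with h
  · rw [h, prefixSet_succ, hσ]
    simp [prefixSet_zero, hF₀]
  · rfl

lemma sum_prefixSet_succ {N : ℕ} (σ : Equiv.Perm (Fin N)) (l : Fin N) (x : Fin N → ℝ) :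
    ∑ k ∈ prefixSet σ (l + 1), x k = x (σ l) + ∑ k ∈ prefixSet σ l, x k := by
  rw [prefixSet_succ, Finset.sum_insert (notMem_prefixSet σ l)]

lemma sum_prefixSet_greedyPoint {N : ℕ} {F : Finset (Fin N) → ℝ} (hF₀ : F ∅ = 0)
    (σ : Equiv.Perm (Fin N)) {m : ℕ} (hm : m ≤ N) :
    ∑ k ∈ prefixSet σ m, greedyPoint F σ k = F (prefixSet σ m) := by
  induction m with
  | zero => simp [prefixSet_zero, hF₀]
  | succ m ih =>
    have := sum_prefixSet_succ σ ⟨m, hm⟩ (greedyPoint F σ)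
    rw [this, ih (by omega)]
    simp [greedyPoint]

/-- The greedy point satisfies the inequality of `A`, by submodularity applied to the parts of `A` in
successive prefixes. -/
lemma sum_inter_prefixSet_greedyPoint_le {N : ℕ} {F : Finset (Fin N) → ℝ} (hF₀ : F ∅ = 0)
    (hF : IsSubmodular F) (σ : Equiv.Perm (Fin N)) (A : Finset (Fin N)) {m : ℕ} (hm : m ≤ N) :
    ∑ k ∈ A ∩ prefixSet σ m, greedyPoint F σ k ≤ F (A ∩ prefixSet σ m) := by
  induction m with
  | zero => simp [prefixSet_zero, hF₀]
  | succ m ih =>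
    have hsucc : prefixSet σ (m + 1) = insert (σ ⟨m, hm⟩) (prefixSet σ m) :=
      prefixSet_succ σ ⟨m, hm⟩
    have hnot : σ ⟨m, hm⟩ ∉ prefixSet σ m := notMem_prefixSet σ ⟨m, hm⟩
    have ih := ih (by omega)
    by_cases hA : σ ⟨m, hm⟩ ∈ A
    · have h1 : A ∩ prefixSet σ (m + 1) = insert (σ ⟨m, hm⟩) (A ∩ prefixSet σ m) := by
        rw [hsucc, Finset.inter_insert_of_mem hA]
      have h2 : (A ∩ prefixSet σ (m + 1)) ∪ prefixSet σ m = prefixSet σ (m + 1) := by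
        rw [h1, hsucc, Finset.insert_union,
          Finset.union_eq_right.2 (Finset.inter_subset_right)]
      have h3 : (A ∩ prefixSet σ (m + 1)) ∩ prefixSet σ m = A ∩ prefixSet σ m := by
        rw [h1, Finset.insert_inter_of_notMem hnot,
          Finset.inter_eq_left.2 (Finset.inter_subset_right)]
      have h4 := hF (A ∩ prefixSet σ (m + 1)) (prefixSet σ m)
      rw [h2, h3] at h4
      have h5 : greedyPoint F σ (σ ⟨m, hm⟩) = F (prefixSet σ (m + 1)) - F (prefixSet σ m) := by
        simp [greedyPoint]
      have h6 : ∑ k ∈ A ∩ prefixSet σ (m + 1), greedyPoint F σ k =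
          greedyPoint F σ (σ ⟨m, hm⟩) + ∑ k ∈ A ∩ prefixSet σ m, greedyPoint F σ k := by
        rw [h1, Finset.sum_insert fun h => hnot (Finset.mem_inter.1 h).2]
      rw [h6, h5]
      linarith
    · rwa [hsucc, Finset.inter_insert_of_notMem hA]

lemma greedyPoint_mem_basePolyhedron {N : ℕ} {F : Finset (Fin N) → ℝ} (hF₀ : F ∅ = 0)
    (hF : IsSubmodular F) (σ : Equiv.Perm (Fin N)) : greedyPoint F σ ∈ basePolyhedron F := by
  refine ⟨fun A => ?_, ?_⟩
  · have := sum_inter_prefixSet_greedyPoint_le hF₀ hF σ A le_rfl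
    rwa [prefixSet_self, Finset.inter_univ] at this
  · have := sum_prefixSet_greedyPoint hF₀ σ (le_refl N)
    rwa [prefixSet_self] at this

/-- The greedy point is the only point of the base polyhedron that is tight on all prefixes of the
order; hence it is a vertex. -/
lemma greedyPoint_mem_vertices {N : ℕ} {F : Finset (Fin N) → ℝ} (hF₀ : F ∅ = 0)
    (hF : IsSubmodular F) (σ : Equiv.Perm (Fin N)) : greedyPoint F σ ∈ vertices F := by
  refine mem_extremePoints_iff_left.2 ⟨greedyPoint_mem_basePolyhedron hF₀ hF σ, ?_⟩
  rintro x hx y hy ⟨a, b, ha, hb, hab, hxy⟩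
  have htight : ∀ m ≤ N, ∑ k ∈ prefixSet σ m, x k = F (prefixSet σ m) := by
    intro m hm
    refine le_antisymm (hx.1 _) ?_
    have h1 := sum_prefixSet_greedyPoint hF₀ σ hm
    rw [← hxy] at h1
    simp only [Pi.add_apply, Pi.smul_apply, smul_eq_mul, Finset.sum_add_distrib,
      ← Finset.mul_sum] at h1
    have h2 := hy.1 (prefixSet σ m)
    have h3 : a * F (prefixSet σ m) + b * F (prefixSet σ m) = F (prefixSet σ m) := by
      rw [← add_mul, hab, one_mul]
    have h4 := mul_le_mul_of_nonneg_left h2 hb.le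
    by_contra hlt
    have h5 := mul_lt_mul_of_pos_left (not_le.1 hlt) ha
    linarith
  funext k
  have h1 := sum_prefixSet_succ σ (σ.symm k) x
  rw [htight _ (σ.symm k).isLt, htight _ (σ.symm k).isLt.le, Equiv.apply_symm_apply] at h1
  simp only [greedyPoint]
  linarith

/-! ### Optimality of the greedy vertices -/

lemma sum_mul_sub_by_parts (w a : ℕ → ℝ) (ha : a 0 = 0) (n : ℕ) :
    ∑ m ∈ Finset.range (n + 1), w m * (a (m + 1) - a m) =
      w n * a (n + 1) + ∑ m ∈ Finset.range n, (w m - w (m + 1)) * a (m + 1) := by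
  induction n with
  | zero => simp [ha]
  | succ n ih =>
    rw [Finset.sum_range_succ, ih, Finset.sum_range_succ _ n]
    ring

/-- Summation by parts: along an order, the loss of `x` against the greedy point is a
combination of the slacks of `x` on the prefixes; the coefficients are the decreases of `u`. -/
lemma sum_mul_greedyPoint_sub {n : ℕ} {F : Finset (Fin (n + 1)) → ℝ} (hF₀ : F ∅ = 0)
    (σ : Equiv.Perm (Fin (n + 1))) (u : Fin (n + 1) → ℝ) {x : Fin (n + 1) → ℝ}
    (hx : x ∈ basePolyhedron F) :
    ∑ k, u k * greedyPoint F σ k - ∑ k, u k * x k =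
      ∑ l : Fin n, (u (σ l.castSucc) - u (σ l.succ)) *
        (F (prefixSet σ (l + 1)) - ∑ k ∈ prefixSet σ (l + 1), x k) := by
  set a : ℕ → ℝ := fun m => F (prefixSet σ m) - ∑ k ∈ prefixSet σ m, x k with ha
  set w : ℕ → ℝ := fun m => if h : m < n + 1 then u (σ ⟨m, h⟩) else 0 with hw
  have h0 : a 0 = 0 := by simp [ha, prefixSet_zero, hF₀]
  have hlast : a (n + 1) = 0 := by
    simp only [ha, prefixSet_self, hx.2, sub_self]
  have h1 : ∑ k, u k * greedyPoint F σ k - ∑ k, u k * x k =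
      ∑ l : Fin (n + 1), w l * (a (l + 1) - a l) := by
    rw [← Finset.sum_sub_distrib, ← Equiv.sum_comp σ]
    refine Finset.sum_congr rfl fun l _ => ?_
    simp only [hw, ha, l.isLt, dif_pos, sum_prefixSet_succ, greedyPoint,
      Equiv.symm_apply_apply, Fin.eta]
    ring
  rw [h1, Fin.sum_univ_eq_sum_range (fun m => w m * (a (m + 1) - a m)),
    sum_mul_sub_by_parts w a h0, hlast, mul_zero, zero_add,
    ← Fin.sum_univ_eq_sum_range (fun m => (w m - w (m + 1)) * a (m + 1))]
  refine Finset.sum_congr rfl fun l _ => ?_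
  have e1 : w l = u (σ l.castSucc) := by
    simp only [hw]
    rw [dif_pos (by omega)]
    rfl
  have e2 : w (l + 1) = u (σ l.succ) := by
    simp only [hw]
    rw [dif_pos (by omega)]
    rfl
  rw [e1, e2]

/-- The greedy point maximizes the linear functional `u` if `u` is non-increasing along `σ`. -/
lemma sum_mul_le_sum_mul_greedyPoint {N : ℕ} {F : Finset (Fin N) → ℝ} (hF₀ : F ∅ = 0)
    {σ : Equiv.Perm (Fin N)} {u : Fin N → ℝ} (hu : Antitone fun l => u (σ l)) {x : Fin N → ℝ}
    (hx : x ∈ basePolyhedron F) : ∑ k, u k * x k ≤ ∑ k, u k * greedyPoint F σ k := by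
  cases N with
  | zero => simp
  | succ n =>
    rw [← sub_nonneg, sum_mul_greedyPoint_sub hF₀ σ u hx]
    exact Finset.sum_nonneg fun l _ => mul_nonneg
      (sub_nonneg.2 (hu (Fin.castSucc_lt_succ).le)) (sub_nonneg.2 (hx.1 _))

/-- Upper level sets of `u` are prefixes of every order along which `u` is non-increasing. -/
lemma exists_prefixSet_eq {N : ℕ} {σ : Equiv.Perm (Fin N)} {u : Fin N → ℝ}
    (hu : Antitone fun l => u (σ l)) {S : Finset (Fin N)}
    (hS : ∀ k ∈ S, ∀ l, l ∉ S → u l < u k) : ∃ m ≤ N, S = prefixSet σ m := by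
  by_cases hall : ∃ m, ∃ h : m < N, σ ⟨m, h⟩ ∉ S
  · classical
    obtain ⟨hlt, hnot⟩ := Nat.find_spec hall
    refine ⟨Nat.find hall, hlt.le, ?_⟩
    ext k
    rw [mem_prefixSet]
    constructor
    · intro hk
      by_contra hge
      have h1 := hS k hk _ hnot
      have h2 := hu (show (⟨Nat.find hall, hlt⟩ : Fin N) ≤ σ.symm k from not_lt.1 hge)
      simp only [Equiv.apply_symm_apply] at h2
      linarith
    · intro hk
      by_contra hkS
      exact Nat.find_min hall hk ⟨(σ.symm k).isLt, by simpa using hkS⟩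
  · push Not at hall
    refine ⟨N, le_rfl, ?_⟩
    rw [prefixSet_self, Finset.eq_univ_iff_forall]
    intro k
    have := hall (σ.symm k) (σ.symm k).isLt
    simpa using this

/-- A point of the base polyhedron that maximizes `u` is tight on the upper level sets of `u`. -/
lemma sum_eq_of_sum_mul_eq {N : ℕ} {F : Finset (Fin N) → ℝ} (hF₀ : F ∅ = 0)
    {σ : Equiv.Perm (Fin N)} {u : Fin N → ℝ} (hu : Antitone fun l => u (σ l)) {x : Fin N → ℝ}
    (hx : x ∈ basePolyhedron F) (heq : ∑ k, u k * x k = ∑ k, u k * greedyPoint F σ k)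
    {S : Finset (Fin N)} (hS : ∀ k ∈ S, ∀ l, l ∉ S → u l < u k) : ∑ k ∈ S, x k = F S := by
  obtain ⟨m, hm, rfl⟩ := exists_prefixSet_eq hu hS
  rcases Nat.eq_zero_or_pos m with rfl | hpos
  · simp [prefixSet_zero, hF₀]
  rcases hm.eq_or_lt with rfl | hlt
  · rw [prefixSet_self]
    exact hx.2
  obtain ⟨n, rfl⟩ : ∃ n, N = n + 1 := ⟨N - 1, by omega⟩
  obtain ⟨l, rfl⟩ : ∃ l : Fin n, m = l + 1 := ⟨⟨m - 1, by omega⟩, by simp; omega⟩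
  have h1 := sum_mul_greedyPoint_sub hF₀ σ u hx
  rw [heq, sub_self] at h1
  have h2 := (Finset.sum_eq_zero_iff_of_nonneg (fun l _ => mul_nonneg
    (sub_nonneg.2 (hu (Fin.castSucc_lt_succ (i := l)).le)) (sub_nonneg.2 (hx.1 _)))).1 h1.symm l
    (Finset.mem_univ _)
  have h3 : u (σ l.succ) < u (σ l.castSucc) := by
    refine hS _ ?_ _ ?_ <;> simp [mem_prefixSet]
  rcases mul_eq_zero.1 h2 with h | h
  · linarith
  · linarith

/-! ### Linear programming duality -/

/-- Weak duality for the linear program over all vertices. -/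
lemma LPFeasible.le_sum_beta {N : ℕ} {F : Finset (Fin N) → ℝ} {θ : vertices F →₀ ℝ}
    {α β : Fin N → ℝ} (h : LPFeasible F θ α β) {u : Fin N → ℝ} {v : ℝ} (hu₀ : ∀ k, 0 ≤ u k)
    (hu₁ : ∀ k, u k ≤ 1) (huv : ∀ x ∈ vertices F, ∑ k, u k * x k + v ≤ 0) : v ≤ ∑ k, β k := by
  obtain ⟨h1, h2, hα, hβ, hθ⟩ := h
  have h3 : (θ.sum fun x w => w * (∑ k, u k * x.1 k + v)) ≤ 0 :=
    Finset.sum_nonpos fun x _ => mul_nonpos_of_nonneg_of_nonpos (hθ x) (huv x.1 x.2)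
  have h4 : (θ.sum fun x w => w * (∑ k, u k * x.1 k + v)) = ∑ k, u k * (α k - β k) + v := by
    have e1 : ∀ k, α k - β k = θ.sum fun x w => w * x.1 k := fun k => by linarith [h1 k]
    have e2 : v = v * θ.sum fun _ w => w := by rw [h2, mul_one]
    conv_rhs => rw [e2]
    simp only [e1, Finsupp.sum, Finset.mul_sum, mul_add, Finset.sum_add_distrib]
    rw [Finset.sum_comm]
    congr 1
    · exact Finset.sum_congr rfl fun k _ => Finset.sum_congr rfl fun x _ => by ring
    · exact Finset.sum_congr rfl fun x _ => by ring
  have h5 : ∀ k, -β k ≤ u k * (α k - β k) := fun k => by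
    nlinarith [mul_nonneg (hu₀ k) (hα k), mul_nonneg (sub_nonneg.2 (hu₁ k)) (hβ k)]
  have h6 := Finset.sum_le_sum fun k (_ : k ∈ Finset.univ) => h5 k
  rw [Finset.sum_neg_distrib] at h6
  linarith

/-- A sum over a basis without artificial columns, split into the variables `θ`, `α`, `β`. -/
lemma sum_eq_sum_gen_add_sum_slack {N : ℕ} {F : Finset (Fin N) → ℝ} {B : Finset (Col N)}
    (hB : (B : Set (Col N)) ⊆ colsOfG F ∪ slackCols N) {z : Col N → ℝ}
    (hz : ∀ c, c ∉ B → z c = 0) {θ : vertices F →₀ ℝ} (hθ : ∀ x, θ x = z (.gen x.1))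
    (f : Col N → ℝ) :
    ∑ c ∈ B, z c * f c = (θ.sum fun x w => w * f (.gen x.1)) +
      (∑ k, z (.alpha k) * f (.alpha k) + ∑ k, z (.beta k) * f (.beta k)) := by
  have hinj : Function.Injective fun x : vertices F => (Col.gen x.1 : Col N) := by
    intro x y h
    simpa [Subtype.ext_iff] using h
  set G : Finset (Col N) := θ.support.image fun x => Col.gen x.1 with hG
  set A : Finset (Col N) := Finset.univ.image Col.alpha with hA
  set E : Finset (Col N) := Finset.univ.image Col.beta with hE
  have hd1 : Disjoint A E := by
    rw [Finset.disjoint_left]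
    simp [hA, hE]
  have hd2 : Disjoint G (A ∪ E) := by
    rw [Finset.disjoint_left]
    intro c hc hc'
    simp only [hG, hA, hE, Finset.mem_image, Finset.mem_union] at hc hc'
    obtain ⟨x, -, rfl⟩ := hc
    simp at hc'
  have hsum : ∑ c ∈ B, z c * f c = ∑ c ∈ G ∪ (A ∪ E), z c * f c := by
    refine Finset.sum_congr_of_eq_on_inter ?_ ?_ fun _ _ _ => rfl
    · intro c hc hc'
      simp only [Finset.mem_union, not_or] at hc'
      rcases hB hc with ⟨x, hx, rfl⟩ | ⟨k, rfl⟩ | ⟨k, rfl⟩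
      · by_cases h0 : θ ⟨x, hx⟩ = 0
        · rw [hθ] at h0
          rw [h0, zero_mul]
        · refine absurd ?_ hc'.1
          exact Finset.mem_image.2 ⟨⟨x, hx⟩, Finsupp.mem_support_iff.2 h0, rfl⟩
      · exact absurd (Finset.mem_image_of_mem _ (Finset.mem_univ k)) hc'.2.1
      · exact absurd (Finset.mem_image_of_mem _ (Finset.mem_univ k)) hc'.2.2
    · intro c _ hc
      rw [hz c hc, zero_mul]
  rw [hsum, Finset.sum_union hd2, Finset.sum_union hd1, hG, hA, hE,
    Finset.sum_image hinj.injOn, Finset.sum_image (fun _ _ _ _ h => by simpa using h),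
    Finset.sum_image (fun _ _ _ _ h => by simpa using h)]
  simp only [Finsupp.sum, hθ]

lemma exists_isBasicSolution {N : ℕ} (F : Finset (Fin N) → ℝ) (B : Finset (Col N)) :
    ∃ (θ : vertices F →₀ ℝ) (α β : Fin N → ℝ), IsBasicSolution F B θ α β := by
  have hfin : (Function.support fun x : vertices F => coord B (rhs N) (.gen x.1)).Finite := by
    refine (B.finite_toSet.preimage (f := fun x : vertices F => (Col.gen x.1 : Col N))
      (fun x _ y _ h => by simpa [Subtype.ext_iff] using h)).subset fun x hx => ?_
    by_contra h
    exact hx (coord_of_notMem _ h)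
  exact ⟨Finsupp.ofSupportFinite _ hfin, _, _, fun _ => rfl, fun _ => rfl, fun _ => rfl⟩

lemma IsBasicSolution.lpFeasible {N : ℕ} {F : Finset (Fin N) → ℝ} {M : ℝ} {B : Finset (Col N)}
    (hB : IsOptimalBasis F M B) {θ : vertices F →₀ ℝ} {α β : Fin N → ℝ}
    (h : IsBasicSolution F B θ α β) : LPFeasible F θ α β := by
  obtain ⟨hsub, hbas, hnn, -⟩ := hB
  have hz : ∀ c, c ∉ B → coord B (rhs N) c = 0 := fun c hc => coord_of_notMem _ hc
  have hnn' : ∀ c, 0 ≤ coord B (rhs N) c := fun c => by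
    by_cases hc : c ∈ B
    · exact hnn c hc
    · exact (hz c hc).ge
  have hrow : ∀ j, ∑ c ∈ B, coord B (rhs N) c * c.vec j = rhs N j := fun j => by
    have := congrFun (hbas.sum_coord (rhs N)) j
    simpa using this
  refine ⟨fun l => ?_, ?_, fun k => ?_, fun k => ?_, fun x => ?_⟩
  · have := hrow l.castSucc
    rw [sum_eq_sum_gen_add_sum_slack hsub hz h.1] at this
    simp only [← h.2.1, ← h.2.2, Col.vec] at this
    simp [Pi.single_apply, rhs] at this
    linarith
  · have := hrow (Fin.last N)
    rw [sum_eq_sum_gen_add_sum_slack hsub hz h.1] at this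
    simpa [Col.vec, rhs] using this
  · rw [h.2.1]; exact hnn' _
  · rw [h.2.2]; exact hnn' _
  · rw [h.1]; exact hnn' _

/-- The cost of the basic solution is the dual objective value. -/
lemma IsBasicSolution.sum_beta {N : ℕ} {F : Finset (Fin N) → ℝ} {M : ℝ} {B : Finset (Col N)}
    (hB : IsOptimalBasis F M B) {θ : vertices F →₀ ℝ} {α β : Fin N → ℝ}
    (h : IsBasicSolution F B θ α β) : ∑ k, β k = dualVec M B (Fin.last N) := by
  have h1 : dualVec M B (Fin.last N) = ∑ c ∈ B, coord B (rhs N) c * c.cost M :=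
    Finset.sum_congr rfl fun c _ => mul_comm _ _
  rw [h1, sum_eq_sum_gen_add_sum_slack hB.1 (fun c hc => coord_of_notMem _ hc) h.1]
  simp [Col.cost, ← h.2.2]

lemma IsOptimalBasis.dualU_nonneg {N : ℕ} {F : Finset (Fin N) → ℝ} {M : ℝ} {B : Finset (Col N)}
    (hB : IsOptimalBasis F M B) (k : Fin N) : 0 ≤ dualU M B k := by
  rw [← redCost_alpha]
  exact hB.2.2.2 _ (Or.inr (Or.inl ⟨k, rfl⟩))

lemma IsOptimalBasis.dualU_le_one {N : ℕ} {F : Finset (Fin N) → ℝ} {M : ℝ} {B : Finset (Col N)}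
    (hB : IsOptimalBasis F M B) (k : Fin N) : dualU M B k ≤ 1 := by
  rw [← sub_nonneg, ← redCost_beta]
  exact hB.2.2.2 _ (Or.inr (Or.inr ⟨k, rfl⟩))

lemma IsOptimalBasis.dual_feasible {N : ℕ} {F : Finset (Fin N) → ℝ} {M : ℝ}
    {B : Finset (Col N)} (hB : IsOptimalBasis F M B) {x : Fin N → ℝ} (hx : x ∈ vertices F) :
    ∑ k, dualU M B k * x k + dualVec M B (Fin.last N) ≤ 0 := by
  have := hB.2.2.2 (.gen x) (Or.inl ⟨x, hx, rfl⟩)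
  rw [redCost_gen] at this
  linarith

lemma IsBasicSolution.lpOptimal {N : ℕ} {F : Finset (Fin N) → ℝ} {M : ℝ} {B : Finset (Col N)}
    (hB : IsOptimalBasis F M B) {θ : vertices F →₀ ℝ} {α β : Fin N → ℝ}
    (h : IsBasicSolution F B θ α β) : LPOptimal F θ α β := by
  refine ⟨h.lpFeasible hB, fun θ' α' β' h' => ?_⟩
  rw [h.sum_beta hB]
  exact h'.le_sum_beta hB.dualU_nonneg hB.dualU_le_one fun x hx => hB.dual_feasible hx

/-- A lexicographically optimal basis whose dual vector prices out one greedy vertex for this dual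
vector prices out all vertices. -/
lemma IsLexOptimalBasis.isOptimalBasis {N : ℕ} {F : Finset (Fin N) → ℝ} (hF₀ : F ∅ = 0) {M : ℝ}
    {C : Set (Col N)} {L : Finset (Col N)} (hL : IsLexOptimalBasis M C L)
    (hC : slackCols N ⊆ C) (hsub : (L : Set (Col N)) ⊆ colsOfG F ∪ slackCols N)
    {σ : Equiv.Perm (Fin N)} (hσ : Antitone fun l => dualU M L (σ l))
    (hg : 0 ≤ redCost M L (.gen (greedyPoint F σ))) : IsOptimalBasis F M L := by
  refine ⟨hsub, hL.2.1, fun c hc => ?_, fun d hd => ?_⟩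
  · exact LexPos.nonneg_zero (hL.2.2.1 c hc)
  · rcases hd with ⟨x, hx, rfl⟩ | hd
    · have := sum_mul_le_sum_mul_greedyPoint hF₀ hσ hx.1
      rw [redCost_gen] at hg ⊢
      linarith
    · exact hL.redCost_nonneg (hC hd)

/-! ### Integrality of the dual vector -/

/-- A vector on which all columns of a basis vanish is zero. -/
lemma IsBasis.eq_zero_of_forall_sum_mul_vec_eq_zero {N : ℕ} {B : Finset (Col N)} (hB : IsBasis B)
    {y : Fin (N + 1) → ℝ} (h : ∀ c ∈ B, ∑ j, y j * c.vec j = 0) : y = 0 := by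
  funext k
  have h1 : ∑ j, y j * (Pi.single k 1 : Fin (N + 1) → ℝ) j = y k := by
    simp [Pi.single_apply]
  rw [← h1, ← hB.sum_coord (Pi.single k 1)]
  simp only [Finset.sum_apply, Pi.smul_apply, smul_eq_mul, Finset.mul_sum]
  rw [Finset.sum_comm]
  refine Finset.sum_eq_zero fun c hc => ?_
  have := congrArg (coord B (Pi.single k 1) c * ·) (h c hc)
  simp only [Finset.mul_sum, mul_zero] at this
  rw [← this]
  exact Finset.sum_congr rfl fun j _ => by ring

lemma IsOptimalBasis.sum_mul_eq_of_mem {N : ℕ} {F : Finset (Fin N) → ℝ} (hF₀ : F ∅ = 0)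
    (hF : IsSubmodular F) {M : ℝ} {B : Finset (Col N)} (hB : IsOptimalBasis F M B)
    {σ : Equiv.Perm (Fin N)} (hσ : Antitone fun l => dualU M B (σ l)) {x : Fin N → ℝ}
    (hx : x ∈ vertices F) (hxB : Col.gen x ∈ B) :
    ∑ k, dualU M B k * x k = ∑ k, dualU M B k * greedyPoint F σ k := by
  refine le_antisymm (sum_mul_le_sum_mul_greedyPoint hF₀ hσ hx.1) ?_
  have h1 := hB.2.1.redCost_of_mem M hxB
  rw [redCost_gen] at h1
  have h2 := hB.dual_feasible (greedyPoint_mem_vertices hF₀ hF σ)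
  linarith

/-- The dual vector of an optimal basis has no fractional entry: if `s` were one, then the
indicator vector of the level set `{u = s}`, extended by the common value of `-x({u = s})` on the
vertices `x` that maximize `u`, would vanish on all columns of the basis. -/
lemma IsOptimalBasis.dualU_eq_zero_or_one {N : ℕ} {F : Finset (Fin N) → ℝ} (hF₀ : F ∅ = 0)
    (hF : IsSubmodular F) {M : ℝ} {B : Finset (Col N)} (hB : IsOptimalBasis F M B)
    {σ : Equiv.Perm (Fin N)} (hσ : Antitone fun l => dualU M B (σ l)) (k : Fin N) :
    dualU M B k = 0 ∨ dualU M B k = 1 := by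
  by_contra! hcon
  set u := dualU M B with hu
  set S₁ : Finset (Fin N) := Finset.univ.filter fun l => u k ≤ u l with hS₁
  set S₂ : Finset (Fin N) := Finset.univ.filter fun l => u k < u l with hS₂
  set y : Fin (N + 1) → ℝ := Fin.snoc (α := fun _ => ℝ)
    (fun l => if u l = u k then 1 else 0) (-(F S₁ - F S₂)) with hy
  have hlevel : ∀ x : Fin N → ℝ, ∑ l, (if u l = u k then (1 : ℝ) else 0) * x l =
      ∑ l ∈ S₁, x l - ∑ l ∈ S₂, x l := by
    intro x
    rw [hS₁, hS₂, Finset.sum_filter, Finset.sum_filter, ← Finset.sum_sub_distrib]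
    refine Finset.sum_congr rfl fun l _ => ?_
    rcases lt_trichotomy (u k) (u l) with h | h | h
    · simp [h, h.le, h.ne']
    · simp [h]
    · simp [h.not_gt, h.not_ge, h.ne]
  have hzero : y = 0 := by
    refine hB.2.1.eq_zero_of_forall_sum_mul_vec_eq_zero fun c hc => ?_
    have hred := hB.2.1.redCost_of_mem M hc
    rcases hB.1 hc with ⟨x, hx, rfl⟩ | ⟨l, rfl⟩ | ⟨l, rfl⟩
    · have hmax := hB.sum_mul_eq_of_mem hF₀ hF hσ hx hc
      have h1 : ∑ l ∈ S₁, x l = F S₁ := by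
        refine sum_eq_of_sum_mul_eq hF₀ hσ hx.1 hmax fun a ha b hb => ?_
        simp only [hS₁, Finset.mem_filter, Finset.mem_univ, true_and, not_le] at ha hb
        exact hb.trans_le ha
      have h2 : ∑ l ∈ S₂, x l = F S₂ := by
        refine sum_eq_of_sum_mul_eq hF₀ hσ hx.1 hmax fun a ha b hb => ?_
        simp only [hS₂, Finset.mem_filter, Finset.mem_univ, true_and, not_lt] at ha hb
        exact hb.trans_lt ha
      rw [Fin.sum_univ_castSucc]
      simp only [hy, Col.vec, Fin.snoc_castSucc, Fin.snoc_last]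
      rw [hlevel, h1, h2]
      ring
    · rw [redCost_alpha, ← hu] at hred
      have : u l ≠ u k := by rw [hred]; exact hcon.1.symm
      simp [Col.vec, Pi.single_apply, hy, this]
    · rw [redCost_beta, ← hu] at hred
      have : u l ≠ u k := fun h => hcon.2 (by linarith)
      simp [Col.vec, Pi.single_apply, hy, this]
  have := congrFun hzero k.castSucc
  simp [hy] at this

/-- The dual vector of an optimal basis is the indicator vector of a minimizer of `F`. -/
lemma IsOptimalBasis.exists_minimizer {N : ℕ} {F : Finset (Fin N) → ℝ} (hF₀ : F ∅ = 0)
    (hF : IsSubmodular F) {M : ℝ} {B : Finset (Col N)} (hB : IsOptimalBasis F M B)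
    {σ : Equiv.Perm (Fin N)} (hσ : Antitone fun l => dualU M B (σ l)) :
    ∃ X : Finset (Fin N), dualU M B = indicatorVec X ∧ ∀ Y, F X ≤ F Y := by
  set X : Finset (Fin N) := Finset.univ.filter fun k => dualU M B k = 1 with hX
  have hu : dualU M B = indicatorVec X := by
    funext k
    rcases hB.dualU_eq_zero_or_one hF₀ hF hσ k with h | h <;> simp [indicatorVec, hX, h]
  refine ⟨X, hu, fun Y => ?_⟩
  have hsum : ∀ (Z : Finset (Fin N)) (x : Fin N → ℝ),
      ∑ k, indicatorVec Z k * x k = ∑ k ∈ Z, x k := by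
    intro Z x
    simp [indicatorVec]
  have h1 := hB.dual_feasible (greedyPoint_mem_vertices hF₀ hF σ)
  have h2 : ∑ k ∈ X, greedyPoint F σ k = F X := by
    refine sum_eq_of_sum_mul_eq hF₀ hσ (greedyPoint_mem_basePolyhedron hF₀ hF σ) rfl ?_
    intro k hk l hl
    rw [hu]
    simp [indicatorVec, hk, hl]
  rw [hu, hsum, h2] at h1
  obtain ⟨θ, α, β, hbs⟩ := exists_isBasicSolution F B
  have h3 := (hbs.lpFeasible hB).le_sum_beta (u := indicatorVec Y) (v := -F Y)
    (fun k => by unfold indicatorVec; split_ifs <;> norm_num)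
    (fun k => by unfold indicatorVec; split_ifs <;> norm_num)
    (fun x hx => by rw [hsum]; linarith [hx.1.1 Y])
  rw [hbs.sum_beta hB] at h3
  linarith

/-! ### A single round of the algorithm -/

/-- The columns that the greedy algorithm can generate. -/
def greedyCols {N : ℕ} (F : Finset (Fin N) → ℝ) : Set (Col N) :=
  Set.range fun σ : Equiv.Perm (Fin N) => Col.gen (greedyPoint F σ)

lemma greedyCols_finite {N : ℕ} (F : Finset (Fin N) → ℝ) : (greedyCols F).Finite :=
  Set.finite_range _

lemma slackCols_finite (N : ℕ) : (slackCols N).Finite :=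
  (Set.finite_range _).union (Set.finite_range _)

lemma greedyCols_subset_colsOfG {N : ℕ} {F : Finset (Fin N) → ℝ} (hF₀ : F ∅ = 0)
    (hF : IsSubmodular F) : greedyCols F ⊆ colsOfG F := by
  rintro _ ⟨σ, rfl⟩
  exact ⟨_, greedyPoint_mem_vertices hF₀ hF σ, rfl⟩

lemma vec_last_of_mem_greedyCols {N : ℕ} {F : Finset (Fin N) → ℝ} {c : Col N}
    (hc : c ∈ greedyCols F) : c.vec (Fin.last N) = 1 := by
  obtain ⟨σ, rfl⟩ := hc
  simp [Col.vec]

lemma localGreedy_eq_some {N : ℕ} [NeZero N] {F : Finset (Fin N) → ℝ} (hF₀ : F ∅ = 0) {i : Fin N}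
    {σ : Equiv.Perm (Fin N)} (hσ : σ 0 = i) :
    localGreedy F i σ = some (.gen (greedyPoint F σ)) := by
  rw [localGreedy, if_pos hσ, greedyVertex_eq_greedyPoint hF₀ hσ]

lemma mem_greedyCols_of_localGreedy {N : ℕ} [NeZero N] {F : Finset (Fin N) → ℝ} (hF₀ : F ∅ = 0)
    {i : Fin N} {σ : Equiv.Perm (Fin N)} {d : Col N} (hd : localGreedy F i σ = some d) :
    d ∈ greedyCols F := by
  by_cases hσ : σ 0 = i
  · rw [localGreedy_eq_some hF₀ hσ, Option.some_inj] at hd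
    exact ⟨σ, hd⟩
  · simp [localGreedy, hσ] at hd

/-- The sorting key puts `i` before all other indices with the same entry of `u`. -/
lemma exists_isSort {N : ℕ} [NeZero N] (u : Fin N → ℝ) (i : Fin N) : ∃ σ, IsSort u i σ := by
  set f : Fin N → ℝ ×ₗ ℕ := fun k => toLex (-u k, if k = i then 0 else 1)
  have hmono := Tuple.monotone_sort f
  refine ⟨Tuple.sort f, fun k l hkl => ?_, fun hmax => ?_⟩
  · rcases Prod.Lex.le_iff.1 (hmono hkl) with h | h
    · exact (neg_lt_neg_iff.1 h).le
    · exact (neg_inj.1 h.1).ge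
  · have h0 := hmono (Fin.zero_le ((Tuple.sort f).symm i))
    simp only [Function.comp_apply, Equiv.apply_symm_apply] at h0
    rcases Prod.Lex.le_iff.1 h0 with h | h
    · exact absurd (neg_lt_neg_iff.1 h) (hmax _).not_gt
    · have h2 := h.2
      by_contra hne
      have e1 : (ofLex (f (Tuple.sort f 0))).2 = 1 := if_neg hne
      have e2 : (ofLex (f i)).2 = 0 := if_pos rfl
      omega

/-- A basis without artificial columns contains a column of a point, since the slack columns do
not reach the last constraint. -/
lemma IsBasis.exists_mem_of_subset_union_slackCols {N : ℕ} {B : Finset (Col N)} (hB : IsBasis B)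
    {G : Set (Col N)} (hsub : (B : Set (Col N)) ⊆ G ∪ slackCols N) : ∃ c ∈ B, c ∈ G := by
  by_contra! hcon
  have : (Pi.single (Fin.last N) 1 : Fin (N + 1) → ℝ) = 0 := by
    refine hB.eq_zero_of_forall_sum_mul_vec_eq_zero fun c hc => ?_
    have := vec_last_of_mem_slackCols ((hsub hc).resolve_left (hcon c hc))
    simp [Pi.single_apply, this]
  have := congrFun this (Fin.last N)
  simp at this

/-- From round one on, the agents solve linear programs of greedy and slack columns, and the bases
after the pivot consist of such columns. -/
lemma IsPivot.isLexFeasible_and_subset {N : ℕ} [NeZero N] {F : Finset (Fin N) → ℝ}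
    (hF₀ : F ∅ = 0) {M : ℝ} {L B' : Finset (Col N)} {i : Fin N} {σ : Equiv.Perm (Fin N)}
    (hL : IsLexFeasible L) (hsub : (L : Set (Col N)) ⊆ greedyCols F ∪ slackCols N)
    (hp : IsPivot M L (localGreedy F i σ) B') :
    IsLexFeasible B' ∧ (B' : Set (Col N)) ⊆ greedyCols F ∪ slackCols N := by
  rcases hp.cases hL with ⟨rfl, -⟩ | ⟨h1, -, d, hd, -, h2⟩
  · exact ⟨hL, hsub⟩
  · refine ⟨h1, fun c hc => ?_⟩
    rcases Finset.mem_insert.1 (h2 hc) with rfl | h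
    · exact Or.inl (mem_greedyCols_of_localGreedy hF₀ hd)
    · exact hsub h

/-- In the initial round the dual vector is `(1, …, 1, M)`: every agent has priority in the sort,
and its greedy column enters the basis. -/
lemma IsPivot.of_initBasis {N : ℕ} [NeZero N] {F : Finset (Fin N) → ℝ}
    (hF₀ : F ∅ = 0) (hF : IsSubmodular F) {M : ℝ} (hM : -F Finset.univ < M)
    {B' : Finset (Col N)} {i : Fin N} {σ : Equiv.Perm (Fin N)}
    (hσ : IsSort (dualU M (initBasis N)) i σ)
    (hp : IsPivot M (initBasis N) (localGreedy F i σ) B') :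
    ∃ d ∈ B', d ∈ greedyCols F ∧ B' ⊆ insert d (initBasis N) := by
  have hσ0 : σ 0 = i := hσ.2 fun k => by rw [dualU_initBasis, dualU_initBasis]
  have hneg : redCost M (initBasis N) (.gen (greedyPoint F σ)) < 0 := by
    rw [redCost_gen, dualVec_last_initBasis]
    simp only [dualU_initBasis, one_mul, (greedyPoint_mem_basePolyhedron hF₀ hF σ).2]
    linarith
  rcases hp.cases (isLexFeasible_initBasis N) with ⟨-, h⟩ | ⟨-, -, d, hd, hdB, hsub⟩
  · exact absurd hneg (h _ (localGreedy_eq_some hF₀ hσ0)).not_gt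
  · exact ⟨d, hdB, mem_greedyCols_of_localGreedy hF₀ hd, hsub⟩

/-! ### Invariants of a run -/

/-- The bases `b` of the agents before round `t`: the initial basis if `t = 0`, and bases with at
least one greedy column and without columns of other points if `t > 0`. Artificial columns may
still be present then, if `t = 1`. -/
def RoundInvariant {N : ℕ} (F : Finset (Fin N) → ℝ) (t : ℕ) (b : Fin N → Finset (Col N)) : Prop :=
  (t = 0 → ∀ i, b i = initBasis N) ∧
  (t ≠ 0 → ∀ i, (b i : Set (Col N)) ⊆ greedyCols F ∪ (Set.range Col.art ∪ slackCols N) ∧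
    ∃ c ∈ b i, c ∈ greedyCols F)

lemma localCols_finite {N : ℕ} (F : Finset (Fin N) → ℝ) (𝒢 : ℕ → Digraph (Fin N))
    (B : ℕ → Fin N → Finset (Col N)) (t : ℕ) (i : Fin N) : (localCols F 𝒢 B t i).Finite := by
  refine (Set.finite_iUnion fun j => (B t j).finite_toSet).subset ?_
  rintro c ⟨j, -, hc⟩
  refine Set.mem_iUnion.2 ⟨j, ?_⟩
  cases t with
  | zero => exact hc
  | succ s => exact hc.1

lemma localCols_zero {N : ℕ} {F : Finset (Fin N) → ℝ} {𝒢 : ℕ → Digraph (Fin N)}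
    {B : ℕ → Fin N → Finset (Col N)} (h : ∀ i, B 0 i = initBasis N) (i : Fin N) :
    localCols F 𝒢 B 0 i = initBasis N := by
  ext c
  constructor
  · rintro ⟨j, -, hc⟩
    rw [← h j]
    exact hc
  · intro hc
    refine ⟨i, Or.inr rfl, ?_⟩
    rw [← h i] at hc
    exact hc

lemma localCols_subset_greedyCols {N : ℕ} {F : Finset (Fin N) → ℝ} {𝒢 : ℕ → Digraph (Fin N)}
    {B : ℕ → Fin N → Finset (Col N)} {t : ℕ} (ht : t ≠ 0) (h : RoundInvariant F t (B t))
    (i : Fin N) : localCols F 𝒢 B t i ⊆ greedyCols F := by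
  rintro c ⟨j, -, hc⟩
  obtain ⟨s, rfl⟩ := Nat.exists_eq_succ_of_ne_zero ht
  obtain ⟨x, -, rfl⟩ := hc.2
  rcases (h.2 ht j).1 hc.1 with h' | ⟨k, hk⟩ | ⟨k, hk⟩ | ⟨k, hk⟩
  · exact h'
  all_goals exact absurd hk (by simp)

lemma mem_localCols_of_mem_colsOfG {N : ℕ} {F : Finset (Fin N) → ℝ} {𝒢 : ℕ → Digraph (Fin N)}
    {B : ℕ → Fin N → Finset (Col N)} {t : ℕ} {i j : Fin N} (hij : (𝒢 t).Adj j i ∨ j = i)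
    {c : Col N} (hc : c ∈ B t j) (hcG : c ∈ colsOfG F) : c ∈ localCols F 𝒢 B t i := by
  refine ⟨j, hij, ?_⟩
  cases t with
  | zero => exact hc
  | succ s => exact ⟨hc, hcG⟩

/-- Agent `i` performs round `t` with local optimal basis `L` and order `σ`. -/
def IsRound {N : ℕ} [NeZero N] (F : Finset (Fin N) → ℝ) (M : ℝ) (𝒢 : ℕ → Digraph (Fin N))
    (B : ℕ → Fin N → Finset (Col N)) (t : ℕ) (i : Fin N) (u : Fin N → ℝ) (B' L : Finset (Col N))
    (σ : Equiv.Perm (Fin N)) : Prop :=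
  IsLexOptimalBasis M (localCols F 𝒢 B t i ∪ slackCols N) L ∧ u = dualU M L ∧ IsSort u i σ ∧
    IsPivot M L (localGreedy F i σ) B'

lemma roundInvariant_zero {N : ℕ} (F : Finset (Fin N) → ℝ) :
    RoundInvariant F 0 fun _ => initBasis N :=
  ⟨fun _ _ => rfl, fun h => absurd rfl h⟩

lemma initBasis_optimal_round_zero {N : ℕ} {F : Finset (Fin N) → ℝ} {M : ℝ} (hM : 1 < M)
    {𝒢 : ℕ → Digraph (Fin N)} {B : ℕ → Fin N → Finset (Col N)} (h : ∀ i, B 0 i = initBasis N)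
    (i : Fin N) :
    IsLexOptimalBasis M (localCols F 𝒢 B 0 i ∪ slackCols N) (initBasis N) := by
  rw [localCols_zero h]
  exact isLexOptimalBasis_initBasis hM
    (Set.union_subset (initBasis_subset N) Set.subset_union_right) Set.subset_union_left

lemma RoundInvariant.exists_isRound {N : ℕ} [NeZero N] {F : Finset (Fin N) → ℝ} (hF₀ : F ∅ = 0)
    (hF : IsSubmodular F) {M : ℝ} (hM : 1 < M) {𝒢 : ℕ → Digraph (Fin N)}
    {B : ℕ → Fin N → Finset (Col N)} {t : ℕ} (h : RoundInvariant F t (B t)) (i : Fin N) :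
    ∃ u B' L σ, IsRound F M 𝒢 B t i u B' L σ := by
  have hM0 : 0 < M := one_pos.trans hM
  have hL : ∃ L, IsLexOptimalBasis M (localCols F 𝒢 B t i ∪ slackCols N) L := by
    by_cases ht : t = 0
    · subst ht
      exact ⟨_, initBasis_optimal_round_zero hM (h.1 rfl) i⟩
    · obtain ⟨c, hc, hcg⟩ := (h.2 ht i).2
      refine exists_isLexOptimalBasis hM0
        ((localCols_finite F 𝒢 B t i).union (slackCols_finite N))
        (isLexFeasible_slackBasis (vec_last_of_mem_greedyCols hcg))
        (slackBasis_subset (Or.inl ?_) Set.subset_union_right)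
      exact mem_localCols_of_mem_colsOfG (Or.inr rfl) hc (greedyCols_subset_colsOfG hF₀ hF hcg)
  obtain ⟨L, hL⟩ := hL
  obtain ⟨σ, hσ⟩ := exists_isSort (dualU M L) i
  obtain ⟨B', hB'⟩ := exists_isPivot hM0.le hL.2.1 (localGreedy F i σ)
  exact ⟨_, B', L, σ, hL, rfl, hσ, hB'⟩

lemma IsRound.subset_greedyCols {N : ℕ} [NeZero N] {F : Finset (Fin N) → ℝ} {M : ℝ}
    {𝒢 : ℕ → Digraph (Fin N)} {B : ℕ → Fin N → Finset (Col N)} {t : ℕ}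
    (ht : t ≠ 0) (h : RoundInvariant F t (B t)) {i : Fin N} {u : Fin N → ℝ}
    {B' L : Finset (Col N)} {σ : Equiv.Perm (Fin N)} (hr : IsRound F M 𝒢 B t i u B' L σ) :
    (L : Set (Col N)) ⊆ greedyCols F ∪ slackCols N :=
  hr.1.1.trans (Set.union_subset_union_left _ (localCols_subset_greedyCols ht h i))

lemma RoundInvariant.succ {N : ℕ} [NeZero N] {F : Finset (Fin N) → ℝ} (hF₀ : F ∅ = 0)
    (hF : IsSubmodular F) {M : ℝ} (hM : 1 < M) (hMF : -F Finset.univ < M)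
    {𝒢 : ℕ → Digraph (Fin N)} {B : ℕ → Fin N → Finset (Col N)} {t : ℕ}
    (h : RoundInvariant F t (B t)) {u : Fin N → Fin N → ℝ} {b : Fin N → Finset (Col N)}
    (hr : ∀ i, ∃ L σ, IsRound F M 𝒢 B t i (u i) (b i) L σ) : RoundInvariant F (t + 1) b := by
  refine ⟨fun h0 => absurd h0 (Nat.succ_ne_zero t), fun _ i => ?_⟩
  obtain ⟨L, σ, hL⟩ := hr i
  by_cases ht : t = 0
  · subst ht
    obtain rfl : initBasis N = L :=
      (initBasis_optimal_round_zero hM (h.1 rfl) i).unique (one_pos.trans hM).ne' hL.1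
    have hσ := hL.2.2.1
    rw [hL.2.1] at hσ
    obtain ⟨d, hd, hdg, hsub⟩ := IsPivot.of_initBasis hF₀ hF hMF hσ hL.2.2.2
    refine ⟨fun c hc => ?_, d, hd, hdg⟩
    rcases Finset.mem_insert.1 (hsub hc) with rfl | hc'
    · exact Or.inl hdg
    · exact Or.inr (initBasis_subset N hc')
  · have h1 := IsPivot.isLexFeasible_and_subset hF₀ hL.1.isLexFeasible
      (hL.subset_greedyCols ht h) hL.2.2.2
    refine ⟨h1.2.trans (Set.union_subset_union_right _ Set.subset_union_right), ?_⟩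
    exact h1.1.1.exists_mem_of_subset_union_slackCols h1.2

lemma IsRun.roundInvariant {N : ℕ} [NeZero N] {F : Finset (Fin N) → ℝ} (hF₀ : F ∅ = 0)
    (hF : IsSubmodular F) {M : ℝ} (hM : 1 < M) (hMF : -F Finset.univ < M)
    {𝒢 : ℕ → Digraph (Fin N)} {B : ℕ → Fin N → Finset (Col N)} {u : ℕ → Fin N → Fin N → ℝ}
    (hrun : IsRun F M 𝒢 B u) (t : ℕ) : RoundInvariant F t (B t) := by
  induction t with
  | zero =>
    refine ⟨fun _ i => ?_, fun h => absurd rfl h⟩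
    exact (hrun.1 i).unique (one_pos.trans hM).ne'
      (isLexOptimalBasis_initBasis hM subset_rfl (initBasis_subset N))
  | succ t ih => exact ih.succ hF₀ hF hM hMF (hrun.2 t)

lemma localCols_congr {N : ℕ} (F : Finset (Fin N) → ℝ) (𝒢 : ℕ → Digraph (Fin N))
    {B B' : ℕ → Fin N → Finset (Col N)} {t : ℕ} (h : B t = B' t) (i : Fin N) :
    localCols F 𝒢 B t i = localCols F 𝒢 B' t i := by
  cases t <;> simp [localCols, sentCols, h]

/-- The algorithm is well defined. -/
lemma exists_isRun {N : ℕ} [NeZero N] {F : Finset (Fin N) → ℝ} (hF₀ : F ∅ = 0)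
    (hF : IsSubmodular F) {M : ℝ} (hM : 1 < M) (hMF : -F Finset.univ < M)
    (𝒢 : ℕ → Digraph (Fin N)) : ∃ B u, IsRun F M 𝒢 B u := by
  have hstep : ∀ (t : ℕ) (b : Fin N → Finset (Col N)),
      ∃ (b' : Fin N → Finset (Col N)) (u : Fin N → Fin N → ℝ), RoundInvariant F t b →
        ∀ i, ∃ L σ, IsRound F M 𝒢 (fun _ => b) t i (u i) (b' i) L σ := by
    intro t b
    by_cases hb : RoundInvariant F t b
    · choose u b' L σ h using hb.exists_isRound (B := fun _ => b) (𝒢 := 𝒢) hF₀ hF hM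
      exact ⟨b', u, fun _ i => ⟨_, _, h i⟩⟩
    · exact ⟨b, fun _ _ => 0, fun h => absurd h hb⟩
  choose next u hnext using hstep
  set B : ℕ → Fin N → Finset (Col N) := fun t => Nat.rec (fun _ => initBasis N) next t with hB
  have hround : ∀ t, RoundInvariant F t (B t) →
      ∀ i, ∃ L σ, IsRound F M 𝒢 B t i (u t (B t) i) (B (t + 1) i) L σ := by
    intro t ht i
    obtain ⟨L, σ, h⟩ := hnext t (B t) ht i
    refine ⟨L, σ, ?_⟩
    unfold IsRound at h ⊢
    rwa [localCols_congr F 𝒢 (B := fun _ => B t) (B' := B) rfl] at h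
  have hinv : ∀ t, RoundInvariant F t (B t) := by
    intro t
    induction t with
    | zero => exact roundInvariant_zero F
    | succ t ih => exact ih.succ hF₀ hF hM hMF (hround t ih)
  exact ⟨B, fun t => u t (B t),
    fun _ => isLexOptimalBasis_initBasis hM subset_rfl (initBasis_subset N),
    fun t => hround t (hinv t)⟩

/-! ### Consensus -/

lemma exists_eventually_const_of_antitone (r : ℕ → ℕ) (t₀ : ℕ)
    (hr : ∀ t, t₀ ≤ t → r (t + 1) ≤ r t) : ∃ T, t₀ ≤ T ∧ ∀ t, T ≤ t → r t = r T := by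
  obtain ⟨T, hT, hmin⟩ := (measure r).wf.has_min {t | t₀ ≤ t} ⟨t₀, le_refl t₀⟩
  refine ⟨T, hT, fun t ht => le_antisymm ?_ (not_lt.1 (hmin t (hT.trans ht)))⟩
  induction t, ht using Nat.le_induction with
  | base => exact le_rfl
  | succ t ht ih => exact (hr t (hT.trans ht)).trans ih

/-- A gossip argument. Agent `j` sends the state `b t j`, and from the states that it receives
agent `i` forms `l t i`, which equals each of them or has smaller rank; its next state `b (t + 1) i`
is `l t i` or has smaller rank. Over a jointly strongly connected network all states finally agree
for good. -/
lemma exists_consensus {N : ℕ} [NeZero N] {X : Type*} (rank : X → ℕ) {𝒢 : ℕ → Digraph (Fin N)}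
    (h𝒢 : JointlyStronglyConnected 𝒢) (b l : ℕ → Fin N → X) (t₀ : ℕ)
    (hb : ∀ t, t₀ ≤ t → ∀ i, b (t + 1) i = l t i ∨ rank (b (t + 1) i) < rank (l t i))
    (hl : ∀ t, t₀ ≤ t → ∀ i j, (𝒢 t).Adj j i ∨ j = i →
      b t j = l t i ∨ rank (l t i) < rank (b t j)) :
    ∃ T x, t₀ ≤ T ∧ ∀ t, T ≤ t → ∀ i, b t i = x ∧ l t i = x := by
  have hb' : ∀ t, t₀ ≤ t → ∀ i, rank (b (t + 1) i) ≤ rank (l t i) := fun t ht i =>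
    (hb t ht i).elim (fun h => h ▸ le_rfl) le_of_lt
  have hl' : ∀ t, t₀ ≤ t → ∀ i, rank (l t i) ≤ rank (b t i) := fun t ht i =>
    (hl t ht i i (Or.inr rfl)).elim (fun h => h ▸ le_rfl) le_of_lt
  have hconst : ∀ i, ∃ T, t₀ ≤ T ∧ ∀ t, T ≤ t → rank (l t i) = rank (l T i) := fun i =>
    exists_eventually_const_of_antitone (fun t => rank (l t i)) t₀ fun t ht =>
      (hl' (t + 1) (by omega) i).trans (hb' t ht i)
  choose S hS₀ hS using hconst
  set T := Finset.univ.sup S with hT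
  have hST : ∀ i, S i ≤ T := fun i => Finset.le_sup (Finset.mem_univ i)
  have ht₀T : t₀ ≤ T := (hS₀ 0).trans (hST 0)
  have hstep : ∀ t, T ≤ t → ∀ i, b (t + 1) i = l t i ∧ l (t + 1) i = l t i := by
    intro t ht i
    have hr : rank (l (t + 1) i) = rank (l t i) := by
      rw [hS i t ((hST i).trans ht), hS i (t + 1) ((hST i).trans (by omega))]
    have h1 : b (t + 1) i = l t i := by
      rcases hb t (by omega) i with h | h
      · exact h
      · have := hl' (t + 1) (by omega) i
        omega
    refine ⟨h1, ?_⟩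
    rcases hl (t + 1) (by omega) i i (Or.inr rfl) with h | h
    · rw [← h, h1]
    · have := hb' t (by omega) i
      omega
  have hfix : ∀ t, T ≤ t → ∀ i, l t i = l T i := by
    intro t ht i
    induction t, ht using Nat.le_induction with
    | base => rfl
    | succ t ht ih => rw [(hstep t ht i).2, ih]
  have hbfix : ∀ t, T + 1 ≤ t → ∀ i, b t i = l T i := by
    intro t ht i
    obtain ⟨s, rfl⟩ : ∃ s, t = s + 1 := ⟨t - 1, by omega⟩
    rw [(hstep s (by omega) i).1, hfix s (by omega)]
  have hedge : ∀ i j, (∃ τ, T + 1 ≤ τ ∧ (𝒢 τ).Adj i j) →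
      l T i = l T j ∨ rank (l T j) < rank (l T i) := by
    rintro i j ⟨τ, hτ, hadj⟩
    have := hl τ (by omega) j i (Or.inl hadj)
    rwa [hbfix τ hτ, hfix τ (by omega)] at this
  have hle : ∀ i j, rank (l T j) ≤ rank (l T i) := by
    intro i j
    induction h𝒢 (T + 1) i j with
    | refl => exact le_rfl
    | tail _ h ih =>
      rcases hedge _ _ h with h' | h'
      · rwa [← h']
      · exact h'.le.trans ih
  have heq : ∀ i j, l T i = l T j := by
    intro i j
    induction h𝒢 (T + 1) i j with
    | refl => rfl
    | tail _ h ih =>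
      rcases hedge _ _ h with h' | h'
      · rw [ih, h']
      · exact absurd h' (hle _ _).not_gt
  refine ⟨T + 1, l T 0, by omega, fun t ht i => ⟨?_, ?_⟩⟩
  · rw [hbfix t ht, heq i 0]
  · rw [hfix t (by omega), heq i 0]

/-- Among finitely many bases, the number of better ones is a rank. -/
lemma exists_rank_lt_of_lexBetter {N : ℕ} {M : ℝ} (hM : M ≠ 0) {P : Set (Col N)}
    (hP : P.Finite) : ∃ rank : Finset (Col N) → ℕ, ∀ B B' : Finset (Col N),
      (B : Set (Col N)) ⊆ P → LexBetter M B B' → rank B < rank B' := by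
  classical
  refine ⟨fun B => (hP.toFinset.powerset.filter fun B' => LexBetter M B' B).card,
    fun B B' hB h => Finset.card_lt_card ?_⟩
  refine Finset.ssubset_iff_of_subset (fun D hD => ?_) |>.2 ⟨B, ?_, ?_⟩
  · rw [Finset.mem_filter] at hD ⊢
    exact ⟨hD.1, hD.2.trans hM h⟩
  · rw [Finset.mem_filter, Finset.mem_powerset]
    exact ⟨fun c hc => hP.mem_toFinset.2 (hB hc), h⟩
  · rw [Finset.mem_filter]
    exact fun h' => lexBetter_irrefl M B h'.2

theorem theorem1 {N : ℕ} [NeZero N] (F : Finset (Fin N) → ℝ)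
    (hF₀ : F ∅ = 0) (hF : IsSubmodular F) :
    ∃ M₀ : ℝ, ∀ M : ℝ, M₀ ≤ M →
      ∀ 𝒢 : ℕ → Digraph (Fin N), JointlyStronglyConnected 𝒢 →
        (∃ (B : ℕ → Fin N → Finset (Col N)) (u : ℕ → Fin N → Fin N → ℝ), IsRun F M 𝒢 B u) ∧
        ∀ (B : ℕ → Fin N → Finset (Col N)) (u : ℕ → Fin N → Fin N → ℝ), IsRun F M 𝒢 B u →
          ∃ (T : ℕ) (Bstar : Finset (Col N)) (Xstar : Finset (Fin N)),
            IsOptimalBasis F M Bstar ∧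
            (∃ (θ : vertices F →₀ ℝ) (α β : Fin N → ℝ),
              IsBasicSolution F Bstar θ α β ∧ LPOptimal F θ α β) ∧
            (∀ Y : Finset (Fin N), F Xstar ≤ F Y) ∧
            ∀ t, T ≤ t → ∀ i, B t i = Bstar ∧ u t i = indicatorVec Xstar := by
  -- `M > 1` makes the initial basis optimal, and `M > -F(V)` lets every agent pivot in round zero
  refine ⟨2 + |F Finset.univ|, fun M hM 𝒢 h𝒢 => ?_⟩
  have hM1 : 1 < M := by linarith [abs_nonneg (F Finset.univ)]
  have hMF : -F Finset.univ < M := by linarith [neg_abs_le (F Finset.univ)]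
  have hM0 : M ≠ 0 := (one_pos.trans hM1).ne'
  refine ⟨exists_isRun hF₀ hF hM1 hMF 𝒢, fun B u hrun => ?_⟩
  have hinv := hrun.roundInvariant hF₀ hF hM1 hMF
  choose L σ hround using hrun.2
  have hr : ∀ t i, IsRound F M 𝒢 B t i (u t i) (B (t + 1) i) (L t i) (σ t i) := hround
  have hLsub : ∀ t, t ≠ 0 → ∀ i, (L t i : Set (Col N)) ⊆ greedyCols F ∪ slackCols N :=
    fun t ht i => (hr t i).subset_greedyCols ht (hinv t)
  have hBnext : ∀ t, t ≠ 0 → ∀ i, IsLexFeasible (B (t + 1) i) ∧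
      (B (t + 1) i : Set (Col N)) ⊆ greedyCols F ∪ slackCols N := fun t ht i =>
    IsPivot.isLexFeasible_and_subset hF₀ (hr t i).1.isLexFeasible (hLsub t ht i) (hr t i).2.2.2
  obtain ⟨rank, hrank⟩ := exists_rank_lt_of_lexBetter hM0
    ((greedyCols_finite F).union (slackCols_finite N))
  -- the artificial columns are gone from the bases `B t i` only for `t ≥ 2`
  obtain ⟨T, D, hT, hD⟩ := exists_consensus rank h𝒢 B L 2
    (fun t ht i => by
      rcases (hr t i).2.2.2.cases (hr t i).1.isLexFeasible with h | h
      · exact Or.inl h.1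
      · exact Or.inr (hrank _ _ (hBnext t (by omega) i).2 h.2.1))
    (fun t ht i j hij => by
      obtain ⟨s, rfl⟩ : ∃ s, t = s + 1 := ⟨t - 1, by omega⟩
      have hBj := hBnext s (by omega) j
      have hsub : (B (s + 1) j : Set (Col N)) ⊆ localCols F 𝒢 B (s + 1) i ∪ slackCols N := by
        intro c hc
        rcases hBj.2 hc with h | h
        · exact Or.inl (mem_localCols_of_mem_colsOfG hij hc
            (greedyCols_subset_colsOfG hF₀ hF h))
        · exact Or.inr h
      rcases (hr (s + 1) i).1.eq_or_lexBetter hM0 hBj.1 hsub with h | h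
      · exact Or.inl h
      · exact Or.inr (hrank _ _ (hLsub (s + 1) (by omega) i) h))
  have hu : ∀ t, T ≤ t → ∀ i, u t i = dualU M D := fun t ht i => by
    rw [(hr t i).2.1, (hD t ht i).2]
  -- an agent with a maximal entry of the common dual vector runs the greedy algorithm
  obtain ⟨i, hi⟩ := Finite.exists_max (dualU M D)
  have hrT := hr T i
  unfold IsRound at hrT
  rw [hu T le_rfl i, (hD T le_rfl i).2, (hD (T + 1) (by omega) i).1] at hrT
  obtain ⟨hopt, -, hsort, hpiv⟩ := hrT
  have hg : 0 ≤ redCost M D (.gen (greedyPoint F (σ T i))) := by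
    rcases hpiv.cases hopt.isLexFeasible with h | h
    · exact h.2 _ (localGreedy_eq_some hF₀ (hsort.2 hi))
    · exact absurd h.2.1 (lexBetter_irrefl M D)
  have hDsub : (D : Set (Col N)) ⊆ colsOfG F ∪ slackCols N := by
    rw [← (hD T le_rfl i).2]
    exact (hLsub T (by omega) i).trans
      (Set.union_subset_union_left _ (greedyCols_subset_colsOfG hF₀ hF))
  have hDopt : IsOptimalBasis F M D :=
    hopt.isOptimalBasis hF₀ Set.subset_union_right hDsub hsort.1 hg
  obtain ⟨X, hX, hmin⟩ := hDopt.exists_minimizer hF₀ hF hsort.1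
  obtain ⟨θ, α, β, hbs⟩ := exists_isBasicSolution F D
  exact ⟨T, D, X, hDopt, ⟨θ, α, β, hbs, hbs.lpOptimal hDopt⟩, hmin,
    fun t ht j => ⟨(hD t ht j).1, by rw [hu t ht j, hX]⟩⟩
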